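/- **Setting.** There are $N$ subsystems. Subsystem $i$ is the plant $x_{i,t+1}=A_ix_{i,t}+B_iu_{i,t}+w_{i,t}$ with output $y_{i,t}=C_ix_{i,t}+v_{i,t}$, where $x_{i,0}\sim\mathcal N(\bar x_{i,0},X_i)$, $w_{i,t}\sim\mathcal N(0,W_i)$, $v_{i,t}\sim\mathcal N(0,V_i)$. At time $t$ the decision $\delta_{i,t}\in\{0,1\}$ says whether sensor $i$ sends its raw measurement $y_{i,t}$; a sent packet over link $i$ is received with probability $q_i$; $\gamma_{i,t}\in\{0,1\}$ indicates that a packet was sent and received. The initial states, the disturbances, the measurement noises and the link successes, over all times and subsystems, are mutually independent. Let $\theta_{i,t}\in\{0,1\}$ indicate whether subsystem $i$ is triggered at $t$, and let $\mathcal F_t=\{i:\theta_{i,t}=1\}$. Let $\Pi_i\succeq0$ solve $\Pi_i=A_i^T\Pi_iA_i+Q_i-L_i^T(B_i^T\Pi_iB_i+R_i)L_i$ with $L_i=-(B_i^T\Pi_iB_i+R_i)^{-1}B_i^T\Pi_iA_i$, where $Q_i,R_i\succeq0$ and $B_i^T\Pi_iB_i+R_i$ is invertible, and let $\Gamma_{i,\infty}=L_i^T(B_i^T\Pi_iB_i+R_i)L_i$.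 Put $h_i(X)=A_iXA_i^T+W_i$ and $g_i(X)=X-XC_i^T(C_iXC_i^T+V_i)^{-1}C_iX$; the matrices $C_iX_iC_i^T+V_i$ and $C_iW_iC_i^T+V_i$ are assumed invertible (as they are when $V_i\succ0$). The estimator runs the Kalman filter with intermittent observations: $\hat x_{i,0|-1}=\bar x_{i,0}$, $P_{i,0|-1}=X_i$, $$\hat x_{i,t|t}=\hat x_{i,t|t-1}+\gamma_{i,t}K_{i,t}(y_{i,t}-C_i\hat x_{i,t|t-1}),\qquad K_{i,t}=P_{i,t|t-1}C_i^T(C_iP_{i,t|t-1}C_i^T+V_i)^{-1},$$ $P_{i,t|t}=g_i(P_{i,t|t-1})$ if $\gamma_{i,t}=1$ and $P_{i,t|t}=P_{i,t|t-1}$ otherwise, $u_{i,t}=L_i\hat x_{i,t|t}$, $\hat x_{i,t+1|t}=A_i\hat x_{i,t|t}+B_iu_{i,t}$, $P_{i,t+1|t}=h_i(P_{i,t|t})$. Let $\mathcal I_{i,t}$ be the information generated by $\delta_{i,s},\gamma_{i,s},\gamma_{i,s}y_{i,s}$, $s\le t$, and $\mathcal I^k=\bigcup_i\mathcal I_{i,k-1}$.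 A decision $(\delta_{i,k})_i$ at time $k$ is *admissible* if it is a function of $\mathcal I^k$, $\delta_{i,k}=1$ only for $i\in\mathcal F_k$, and $\sum_i\delta_{i,k}\le1$. With $e_{i,k|k}=x_{i,k}-\hat x_{i,k|k}$ let $$J_k=\sum_{i=1}^N\Big(\operatorname{tr}(\Pi_iW_i)+\operatorname{tr}\big(\Gamma_{i,\infty}\,e_{i,k|k}e_{i,k|k}^T\big)\Big).$$ Problem 1 at time $k$: given the past decisions, minimize $\mathbb E\{J_k\mid\mathcal I^k\}$ over all admissible decisions at time $k$. Define $$\mathrm{CoIL}_{i,k}=\operatorname{tr}\big(\Gamma_{i,\infty}[P_{i,k|k-1}-g_i\circ h_i(P_{i,k-1|k-1})]\big),$$ where for $k=0$ the term $h_i(P_{i,k-1|k-1})$ means $P_{i,0|-1}=X_i$. **Proposition 1.** Let $k\ge0$, let the decisions at all times before $k$ be admissible, and let $\mathcal F_k$ be a function of $\mathcal I^k$. Then: 1. $\hat x_{i,t|t-1}$ and $P_{i,t|t-1}$ ($t\le k$) are almost surely the conditional mean and the conditional error covariance of $x_{i,t}$ given $\mathcal I_{i,t-1}$, and $\hat x_{i,t|t}$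 and $P_{i,t|t}$ ($t<k$) are those given $\mathcal I_{i,t}$. 2. For every admissible decision at time $k$, $J_k$ is integrable. 3. Consider a decision at time $k$ that is a function of $\mathcal I^k$, that sets $\delta_{i^*,k}=1$ for exactly one subsystem $i^*\in\arg\max_{i\in\mathcal F_k}\mathrm{CoIL}_{i,k}\,q_i$ when $\mathcal F_k\ne\emptyset$, and that sets all $\delta_{i,k}=0$ when $\mathcal F_k=\emptyset$. Such a decision exists, and every such decision solves Problem 1: it is admissible, and for every admissible decision at time $k$ its value of $\mathbb E\{J_k\mid\mathcal I^k\}$ is almost surely not larger. -/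

import Mathlib

open MeasureTheory ProbabilityTheory Matrix

noncomputable section

namespace WNCS

/-- Data of one subsystem: plant, noise covariances, weights, a matrix `Pi` (the solution of the
algebraic Riccati equation, see `Subsystem.WellPosed`), law of the initial state, and the success
probability `q` of its link. -/
structure Subsystem (n m p : ℕ) where
  A : Matrix (Fin n) (Fin n) ℝ
  B : Matrix (Fin n) (Fin m) ℝ
  C : Matrix (Fin p) (Fin n) ℝ
  /-- covariance of the process disturbance -/
  W : Matrix (Fin n) (Fin n) ℝ
  /-- covariance of the measurement noise -/
  V : Matrix (Fin p) (Fin p) ℝ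
  /-- mean of the initial state -/
  xbar : Fin n → ℝ
  /-- covariance of the initial state -/
  X0 : Matrix (Fin n) (Fin n) ℝ
  Q : Matrix (Fin n) (Fin n) ℝ
  R : Matrix (Fin m) (Fin m) ℝ
  Pi : Matrix (Fin n) (Fin n) ℝ
  q : ℝ

namespace Subsystem

variable {n m p : ℕ} (S : Subsystem n m p)

/-- The matrix `Bᵀ Π B + R`. -/
def M : Matrix (Fin m) (Fin m) ℝ := S.Bᵀ * S.Pi * S.B + S.R

/-- Feedback gain `L = -(Bᵀ Π B + R)⁻¹ Bᵀ Π A`. -/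
def L : Matrix (Fin m) (Fin n) ℝ := -(S.M⁻¹ * S.Bᵀ * S.Pi * S.A)

/-- `Γ = Lᵀ (Bᵀ Π B + R) L`. -/
def Gam : Matrix (Fin n) (Fin n) ℝ := S.Lᵀ * S.M * S.L

/-- `h(X) = A X Aᵀ + W`. -/
def h (X : Matrix (Fin n) (Fin n) ℝ) : Matrix (Fin n) (Fin n) ℝ := S.A * X * S.Aᵀ + S.W

/-- Covariance `C X Cᵀ + V` of the innovation when the prior error covariance is `X`. -/
def innovCov (X : Matrix (Fin n) (Fin n) ℝ) : Matrix (Fin p) (Fin p) ℝ := S.C * X * S.Cᵀ + S.V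

/-- `g(X) = X - X Cᵀ (C X Cᵀ + V)⁻¹ C X`. -/
def g (X : Matrix (Fin n) (Fin n) ℝ) : Matrix (Fin n) (Fin n) ℝ :=
  X - X * S.Cᵀ * (S.innovCov X)⁻¹ * S.C * X

/-- Standing assumptions: covariances and weights are positive semidefinite, `Pi` is a positive
semidefinite solution of the algebraic Riccati equation, and the inverses in `L` and in the filter
exist (the two conditions on `innovCov` hold in particular if `V` is positive definite). -/
structure WellPosed : Prop where
  W_psd : S.W.PosSemidef
  V_psd : S.V.PosSemidef
  X0_psd : S.X0.PosSemidef
  Q_psd : S.Q.PosSemidef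
  R_psd : S.R.PosSemidef
  Pi_psd : S.Pi.PosSemidef
  M_inv : IsUnit S.M.det
  riccati : S.Pi = S.Aᵀ * S.Pi * S.A + S.Q - S.Lᵀ * S.M * S.L
  innov_init : IsUnit (S.innovCov S.X0).det
  innov_noise : IsUnit (S.innovCov S.W).det

/-! One closed loop along a given sequence `γ` of receptions. -/

/-- Prior covariance `P_{t|t-1}` of the filter; `P_{0|-1}` is the covariance of the initial state,
and `P_{t+1|t} = h(P_{t|t})` (see `predCov_succ`). -/
def predCov (γ : ℕ → Bool) : ℕ → Matrix (Fin n) (Fin n) ℝ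
  | 0 => S.X0
  | t + 1 => S.h (if γ t then S.g (predCov γ t) else predCov γ t)

/-- Posterior covariance `P_{t|t}` of the filter. -/
def postCov (γ : ℕ → Bool) (t : ℕ) : Matrix (Fin n) (Fin n) ℝ :=
  if γ t then S.g (S.predCov γ t) else S.predCov γ t

theorem predCov_succ (γ : ℕ → Bool) (t : ℕ) :
    S.predCov γ (t + 1) = S.h (S.postCov γ t) := rfl

/-- Kalman gain `K_t = P_{t|t-1} Cᵀ (C P_{t|t-1} Cᵀ + V)⁻¹`. -/
def gain (γ : ℕ → Bool) (t : ℕ) : Matrix (Fin n) (Fin p) ℝ :=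
  S.predCov γ t * S.Cᵀ * (S.innovCov (S.predCov γ t))⁻¹

/-- Measurement update of the estimate: prior estimate `xp`, output `y`, gain `K`. -/
def update (received : Bool) (K : Matrix (Fin n) (Fin p) ℝ) (xp : Fin n → ℝ) (y : Fin p → ℝ) :
    Fin n → ℝ :=
  if received then xp + K *ᵥ (y - S.C *ᵥ xp) else xp

/-- The pair (state `x_t`, prior estimate `x̂_{t|t-1}`), with `u_t = L x̂_{t|t}`,
`x_{t+1} = A x_t + B u_t + w_t` and `x̂_{t+1|t} = A x̂_{t|t} + B u_t`. -/
def loop (x0 : Fin n → ℝ) (w : ℕ → Fin n → ℝ) (v : ℕ → Fin p → ℝ) (γ : ℕ → Bool) :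
    ℕ → (Fin n → ℝ) × (Fin n → ℝ)
  | 0 => (x0, S.xbar)
  | t + 1 =>
    let x := (loop x0 w v γ t).1
    let xp := (loop x0 w v γ t).2
    let xhat := S.update (γ t) (S.gain γ t) xp (S.C *ᵥ x + v t)
    let u := S.L *ᵥ xhat
    (S.A *ᵥ x + S.B *ᵥ u + w t, S.A *ᵥ xhat + S.B *ᵥ u)

end Subsystem

/-- The random inputs of a network of `N` subsystems: initial states, process disturbances,
measurement noises, and the link states (`link i t ω` says whether a packet sent by sensor `i`
at time `t` gets through). -/
structure Inputs (Ω : Type*) {N : ℕ} (n p : Fin N → ℕ) where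
  x0 : ∀ i, Ω → Fin (n i) → ℝ
  w : ∀ i, ℕ → Ω → Fin (n i) → ℝ
  v : ∀ i, ℕ → Ω → Fin (p i) → ℝ
  link : Fin N → ℕ → Ω → Bool

/-- Labels of the individual random inputs. -/
inductive InputLabel (N : ℕ)
  | x0 (i : Fin N)
  | w (i : Fin N) (t : ℕ)
  | v (i : Fin N) (t : ℕ)
  | link (i : Fin N) (t : ℕ)

section Network

variable {Ω : Type*} {N : ℕ} {n m p : Fin N → ℕ}

/-- The σ-algebra generated by one random input. -/
def Inputs.sigma (ξ : Inputs Ω n p) : InputLabel N → MeasurableSpace Ω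
  | .x0 i => MeasurableSpace.comap (ξ.x0 i) inferInstance
  | .w i t => MeasurableSpace.comap (ξ.w i t) inferInstance
  | .v i t => MeasurableSpace.comap (ξ.v i t) inferInstance
  | .link i t => MeasurableSpace.comap (ξ.link i t) inferInstance

/-- The probabilistic model: all inputs are mutually independent random variables, with Gaussian
initial states and noises, and link `i` succeeds with probability `q_i` at every time. -/
structure Inputs.IsModel [MeasurableSpace Ω] (ξ : Inputs Ω n p)
    (S : ∀ i, Subsystem (n i) (m i) (p i)) (μ : Measure Ω) : Prop where
  x0_meas : ∀ i, Measurable (ξ.x0 i)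
  w_meas : ∀ i t, Measurable (ξ.w i t)
  v_meas : ∀ i t, Measurable (ξ.v i t)
  link_meas : ∀ i t, Measurable (ξ.link i t)
  x0_law : ∀ i, μ.map (fun ω => WithLp.toLp 2 (ξ.x0 i ω)) =
    multivariateGaussian (WithLp.toLp 2 (S i).xbar) (S i).X0
  w_law : ∀ i t, μ.map (fun ω => WithLp.toLp 2 (ξ.w i t ω)) = multivariateGaussian 0 (S i).W
  v_law : ∀ i t, μ.map (fun ω => WithLp.toLp 2 (ξ.v i t ω)) = multivariateGaussian 0 (S i).V
  link_prob : ∀ i t, μ.real {ω | ξ.link i t ω = true} = (S i).q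
  indep : iIndep ξ.sigma μ

/-- A schedule: `δ t ω i` is the channel access decision `δ_{i,t}`. -/
abbrev Schedule (Ω : Type*) (N : ℕ) := ℕ → Ω → Fin N → Bool

variable (S : ∀ i, Subsystem (n i) (m i) (p i)) (ξ : Inputs Ω n p) (δ : Schedule Ω N)

/-- Reception indicator `γ_{i,t}`: sensor `i` transmits and the packet gets through. -/
def recv (i : Fin N) (ω : Ω) (t : ℕ) : Bool := δ t ω i && ξ.link i t ω

/-- The state `x_{i,t}`. -/
def state (i : Fin N) (t : ℕ) (ω : Ω) : Fin (n i) → ℝ :=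
  ((S i).loop (ξ.x0 i ω) (fun s => ξ.w i s ω) (fun s => ξ.v i s ω) (recv ξ δ i ω) t).1

/-- The prior estimate `x̂_{i,t|t-1}`. -/
def estPrior (i : Fin N) (t : ℕ) (ω : Ω) : Fin (n i) → ℝ :=
  ((S i).loop (ξ.x0 i ω) (fun s => ξ.w i s ω) (fun s => ξ.v i s ω) (recv ξ δ i ω) t).2

/-- The output `y_{i,t}`. -/
def output (i : Fin N) (t : ℕ) (ω : Ω) : Fin (p i) → ℝ :=
  (S i).C *ᵥ state S ξ δ i t ω + ξ.v i t ω

/-- The posterior estimate `x̂_{i,t|t}`. -/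
def estPost (i : Fin N) (t : ℕ) (ω : Ω) : Fin (n i) → ℝ :=
  (S i).update (recv ξ δ i ω t) ((S i).gain (recv ξ δ i ω) t) (estPrior S ξ δ i t ω)
    (output S ξ δ i t ω)

/-- `P_{i,t|t-1}`. -/
def covPrior (i : Fin N) (t : ℕ) (ω : Ω) : Matrix (Fin (n i)) (Fin (n i)) ℝ :=
  (S i).predCov (recv ξ δ i ω) t

/-- `P_{i,t|t}`. -/
def covPost (i : Fin N) (t : ℕ) (ω : Ω) : Matrix (Fin (n i)) (Fin (n i)) ℝ :=
  (S i).postCov (recv ξ δ i ω) t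

/-- Prior error `x_{i,t} - x̂_{i,t|t-1}`. -/
def errPrior (i : Fin N) (t : ℕ) (ω : Ω) : Fin (n i) → ℝ :=
  state S ξ δ i t ω - estPrior S ξ δ i t ω

/-- Posterior error `e_{i,t|t} = x_{i,t} - x̂_{i,t|t}`. -/
def errPost (i : Fin N) (t : ℕ) (ω : Ω) : Fin (n i) → ℝ :=
  state S ξ δ i t ω - estPost S ξ δ i t ω

/-- The information of estimator `i` at the start of frame `k`: the σ-algebra generated by
`δ_{i,t}`, `γ_{i,t}` and `γ_{i,t} y_{i,t}` for `t < k`. -/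
def localInfo (i : Fin N) (k : ℕ) : MeasurableSpace Ω :=
  ⨆ t : Fin k, MeasurableSpace.comap
    (fun ω => (δ t ω i, recv ξ δ i ω t, if recv ξ δ i ω t then output S ξ δ i t ω else 0))
    inferInstance

/-- The information of all the estimators together at the start of frame `k`. -/
def info (k : ℕ) : MeasurableSpace Ω := ⨆ i, localInfo S ξ δ i k

/-- The single step cost at time `k`:
`∑ i, (tr (Π_i W_i) + tr (Γ_i e_{i,k|k} e_{i,k|k}ᵀ))`. -/
def stageCost (k : ℕ) (ω : Ω) : ℝ :=
  ∑ i, (((S i).Pi * (S i).W).trace +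
    ((S i).Gam * vecMulVec (errPost S ξ δ i k ω) (errPost S ξ δ i k ω)).trace)

/-- An admissible channel access decision at time `k`: it is determined by the information
available at the start of frame `k`, only triggered subsystems transmit, and at most one
subsystem transmits. -/
structure Admissible (θ : ℕ → Ω → Fin N → Bool) (k : ℕ) (D : Ω → Fin N → Bool) : Prop where
  meas : Measurable[info S ξ δ k] D
  triggered : ∀ ω i, D ω i = true → θ k ω i = true
  single : ∀ ω, ∑ i, (D ω i).toNat ≤ 1

/-- Conditional expected cost at time `k` when the decisions before time `k` are those of `δ`
and the decision at time `k` is `D`. -/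
def objective [MeasurableSpace Ω] (μ : Measure Ω) (k : ℕ) (D : Ω → Fin N → Bool) : Ω → ℝ :=
  μ[stageCost S ξ (Function.update δ k D) k | info S ξ δ k]

/-- `D` solves the one-step problem at time `k`: it is admissible, and almost surely no admissible
decision has a smaller conditional expected cost. -/
def Solves [MeasurableSpace Ω] (μ : Measure Ω) (θ : ℕ → Ω → Fin N → Bool) (k : ℕ)
    (D : Ω → Fin N → Bool) : Prop :=
  Admissible S ξ δ θ k D ∧
    ∀ D' : Ω → Fin N → Bool, Admissible S ξ δ θ k D' →
      objective S ξ δ μ k D ≤ᵐ[μ] objective S ξ δ μ k D'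

/-- `CoIL_{i,k} = tr (Γ_i (P_{i,k|k-1} - g_i (P_{i,k|k-1})))`. -/
def coil (i : Fin N) (k : ℕ) (ω : Ω) : ℝ :=
  ((S i).Gam * (covPrior S ξ δ i k ω - (S i).g (covPrior S ξ δ i k ω))).trace

/-- For `k ≥ 1` the last term in CoIL is `g_i ∘ h_i (P_{i,k-1|k-1})`. -/
theorem coil_succ (i : Fin N) (k : ℕ) (ω : Ω) :
    coil S ξ δ i (k + 1) ω = ((S i).Gam *
      (covPrior S ξ δ i (k + 1) ω - ((S i).g ∘ (S i).h) (covPost S ξ δ i k ω))).trace := rfl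

/-- The decision rule: if some subsystem is triggered, exactly one subsystem transmits, and it
maximizes `CoIL_{i,k} q_i` among the triggered ones; otherwise nobody transmits. Ties may be
broken in any way that uses only the available information. -/
structure IsCoilRule (θ : ℕ → Ω → Fin N → Bool) (k : ℕ) (D : Ω → Fin N → Bool) : Prop where
  meas : Measurable[info S ξ δ k] D
  idle : ∀ ω, (∀ i, θ k ω i = false) → ∀ i, D ω i = false
  argmax : ∀ ω, (∃ i, θ k ω i = true) → ∃ i, θ k ω i = true ∧
    (∀ j, θ k ω j = true → coil S ξ δ j k ω * (S j).q ≤ coil S ξ δ i k ω * (S i).q) ∧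
    ∀ j, D ω j = true ↔ j = i

end Network

end WNCS

end

/-! The difficulty is that the receptions are random and depend on the data: a decision may use
everything that all estimators have received, so the errors are not Gaussian outright. They become
Gaussian once the reception history of subsystem `i` is frozen.

For fixed `i`, let `fullInfo` at time `t` consist of all inputs of the other subsystems, all link
states (future ones included) and the innovations received from `i` before `t`. It contains the
joint information of the estimators (`info_le_fullInfo`), hence also the event that the receptions
of `i` so far equal a given sequence `c`. On that event the prior error has law `N(0, P)`, with `P`
the filter matrix along `c`, and is independent of `fullInfo` (`condLaw_errPrior`). The induction
alternates two steps. At a reception, posterior error and innovation are uncorrelated jointly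
Gaussian vectors, hence independent, so the innovation can be added to the σ-algebra without
affecting the error (`condLaw_errPost_of_errPrior`, from `map_prod_gaussLaw` and
`CondLaw.sup_comap`). The time update adds fresh noise. There are finitely many histories, so these
laws assemble into conditional expectations (`condExp_of_condLaw`), which identifies the filter's
means and covariances.

For the cost, conditioning on `fullInfo` at `k + 1` turns the estimation term of `i` into `tr (Γ
P_{k|k})`, which is `tr (Γ P_{k|k-1})` minus CoIL if the packet is sent and its link works. The link
state is independent of the information at `k` and has mean `q`, so a transmission lowers the
conditional cost by `CoIL * q` (`condExp_trace_errPost`). These gains are nonnegative and at most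
one subsystem transmits, so serving a maximizer is optimal pointwise (`IsCoilRule.sum_le`). -/

namespace WNCS

/-! ### Centred Gaussian laws and their linear images -/

/-- The centred Gaussian law with covariance matrix `P`, on `Fin n → ℝ`. -/
noncomputable def gaussLaw {n : ℕ} (P : Matrix (Fin n) (Fin n) ℝ) : Measure (Fin n → ℝ) :=
  (multivariateGaussian 0 P).map WithLp.ofLp

instance {n : ℕ} (P : Matrix (Fin n) (Fin n) ℝ) : IsProbabilityMeasure (gaussLaw P) :=
  Measure.isProbabilityMeasure_map (by fun_prop)

theorem memLp_eval_gaussLaw {n : ℕ} (P : Matrix (Fin n) (Fin n) ℝ) (a : Fin n) :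
    MemLp (fun x : Fin n → ℝ => x a) 2 (gaussLaw P) := by
  rw [gaussLaw, memLp_map_measure_iff
    (by exact (measurable_pi_apply a).aestronglyMeasurable) (by fun_prop)]
  have h : MemLp id 2 (multivariateGaussian (0 : EuclideanSpace ℝ (Fin n)) P) :=
    IsGaussian.memLp_two_id
  exact (EuclideanSpace.proj a : EuclideanSpace ℝ (Fin n) →L[ℝ] ℝ).comp_memLp' h

theorem integrable_eval_gaussLaw {n : ℕ} (P : Matrix (Fin n) (Fin n) ℝ) (a : Fin n) :
    Integrable (fun x : Fin n → ℝ => x a) (gaussLaw P) :=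
  (memLp_eval_gaussLaw P a).integrable (by norm_num)

theorem integrable_mul_gaussLaw {n : ℕ} (P : Matrix (Fin n) (Fin n) ℝ) (a b : Fin n) :
    Integrable (fun x : Fin n → ℝ => x a * x b) (gaussLaw P) :=
  (memLp_eval_gaussLaw P a).integrable_mul (memLp_eval_gaussLaw P b)

theorem integral_eval_gaussLaw {n : ℕ} (P : Matrix (Fin n) (Fin n) ℝ) (a : Fin n) :
    ∫ x, x a ∂(gaussLaw P) = 0 := by
  rw [gaussLaw, integral_map (by fun_prop) (by exact (measurable_pi_apply a).aestronglyMeasurable)]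
  have h := (EuclideanSpace.proj a : EuclideanSpace ℝ (Fin n) →L[ℝ] ℝ).integral_comp_id_comm
    (μ := multivariateGaussian (0 : EuclideanSpace ℝ (Fin n)) P) IsGaussian.integrable_id
  simpa using h

theorem integral_mul_gaussLaw {n : ℕ} {P : Matrix (Fin n) (Fin n) ℝ} (hP : P.PosSemidef)
    (a b : Fin n) : ∫ x, x a * x b ∂(gaussLaw P) = P a b := by
  have h := covariance_eval_multivariateGaussian (μ := (0 : EuclideanSpace ℝ (Fin n))) hP a b
  have e (c : Fin n) : ∫ x, x c ∂(multivariateGaussian (0 : EuclideanSpace ℝ (Fin n)) P) = 0 := by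
    have := integral_eval_gaussLaw P c
    rwa [gaussLaw, integral_map (by fun_prop)
      (by exact (measurable_pi_apply c).aestronglyMeasurable)] at this
  rw [covariance, e, e] at h
  rw [gaussLaw, integral_map (by fun_prop) (by fun_prop)]
  simpa using h

theorem strongDual_apply_eq_dotProduct {n : ℕ} (L : StrongDual ℝ (Fin n → ℝ)) (x : Fin n → ℝ) :
    L x = (fun i => L (Pi.single i 1)) ⬝ᵥ x := by
  conv_lhs => rw [pi_eq_sum_univ' x]
  simp [dotProduct, mul_comm]

theorem charFunDual_gaussLaw {n : ℕ} {P : Matrix (Fin n) (Fin n) ℝ} (hP : P.PosSemidef)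
    (L : StrongDual ℝ (Fin n → ℝ)) (a : Fin n → ℝ) (hL : ∀ x, L x = a ⬝ᵥ x) :
    charFunDual (gaussLaw P) L = Complex.exp (-((a ⬝ᵥ P *ᵥ a : ℝ) : ℂ) / 2) := by
  have h := charFun_multivariateGaussian (μ := (0 : EuclideanSpace ℝ (Fin n))) hP (WithLp.toLp 2 a)
  rw [charFunDual_apply, gaussLaw, integral_map (by fun_prop) (by fun_prop)]
  rw [charFun_apply] at h
  convert h using 1
  · congr! 5 with x
    rw [hL, EuclideanSpace.inner_eq_star_dotProduct]
    simp
  · congr 1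
    simp [neg_div]

theorem dotProduct_mulVec_transpose {n p k l : ℕ} (M : Matrix (Fin k) (Fin n) ℝ)
    (P : Matrix (Fin n) (Fin p) ℝ) (N : Matrix (Fin l) (Fin p) ℝ) (a : Fin k → ℝ)
    (b : Fin l → ℝ) : (Mᵀ *ᵥ a) ⬝ᵥ P *ᵥ (Nᵀ *ᵥ b) = a ⬝ᵥ (M * P * Nᵀ) *ᵥ b := by
  rw [mulVec_transpose, ← dotProduct_mulVec, mulVec_mulVec, mulVec_mulVec]

/-- A linear image of a pair of independent centred Gaussian vectors is a pair of independent
Gaussian vectors as soon as the cross covariance vanishes. -/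
theorem map_prod_gaussLaw {n p n' p' : ℕ} {P : Matrix (Fin n) (Fin n) ℝ}
    {V : Matrix (Fin p) (Fin p) ℝ} {P' : Matrix (Fin n') (Fin n') ℝ}
    {V' : Matrix (Fin p') (Fin p') ℝ} (hP : P.PosSemidef) (hV : V.PosSemidef)
    (hP' : P'.PosSemidef) (hV' : V'.PosSemidef)
    (A : Matrix (Fin n') (Fin n) ℝ) (B : Matrix (Fin n') (Fin p) ℝ)
    (C : Matrix (Fin p') (Fin n) ℝ) (D : Matrix (Fin p') (Fin p) ℝ)
    (h₁ : A * P * Aᵀ + B * V * Bᵀ = P') (h₂ : C * P * Cᵀ + D * V * Dᵀ = V')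
    (h₃ : A * P * Cᵀ + B * V * Dᵀ = 0) :
    ((gaussLaw P).prod (gaussLaw V)).map
      (fun z => (A *ᵥ z.1 + B *ᵥ z.2, C *ᵥ z.1 + D *ᵥ z.2)) =
    (gaussLaw P').prod (gaussLaw V') := by
  let T : ((Fin n → ℝ) × (Fin p → ℝ)) →L[ℝ] ((Fin n' → ℝ) × (Fin p' → ℝ)) :=
    LinearMap.toContinuousLinearMap
      ((A.mulVecLin.coprod B.mulVecLin).prod (C.mulVecLin.coprod D.mulVecLin))
  have hT : (fun z : (Fin n → ℝ) × (Fin p → ℝ) =>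
      (A *ᵥ z.1 + B *ᵥ z.2, C *ᵥ z.1 + D *ᵥ z.2)) = T := by
    ext z <;> simp [T]
  have : IsProbabilityMeasure (((gaussLaw P).prod (gaussLaw V)).map T) :=
    Measure.isProbabilityMeasure_map (by fun_prop)
  -- The image is the product law as soon as its characteristic function factors; all factors are
  -- exponentials of quadratic forms, so only the exponents need comparing.
  rw [hT, ← charFunDual_eq_prod_iff]
  intro L
  rw [charFunDual_map, charFunDual_prod]
  set a : Fin n' → ℝ := fun i => L.comp (.inl ℝ _ _) (Pi.single i 1) with ha
  set b : Fin p' → ℝ := fun i => L.comp (.inr ℝ _ _) (Pi.single i 1) with hb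
  have hL₁ : ∀ x, L.comp (.inl ℝ _ _) x = a ⬝ᵥ x := strongDual_apply_eq_dotProduct _
  have hL₂ : ∀ x, L.comp (.inr ℝ _ _) x = b ⬝ᵥ x := strongDual_apply_eq_dotProduct _
  have hL : ∀ x y, L (x, y) = a ⬝ᵥ x + b ⬝ᵥ y := fun x y => by
    rw [← hL₁, ← hL₂]
    simp [← map_add]
  rw [charFunDual_gaussLaw hP' _ a hL₁, charFunDual_gaussLaw hV' _ b hL₂,
    charFunDual_gaussLaw hP _ (Aᵀ *ᵥ a + Cᵀ *ᵥ b), charFunDual_gaussLaw hV _ (Bᵀ *ᵥ a + Dᵀ *ᵥ b),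
    ← Complex.exp_add, ← Complex.exp_add]
  · congr 1
    have hPt : Pᵀ = P := hP.isHermitian.eq
    have hVt : Vᵀ = V := hV.isHermitian.eq
    have key : (Aᵀ *ᵥ a + Cᵀ *ᵥ b) ⬝ᵥ P *ᵥ (Aᵀ *ᵥ a + Cᵀ *ᵥ b) +
        (Bᵀ *ᵥ a + Dᵀ *ᵥ b) ⬝ᵥ V *ᵥ (Bᵀ *ᵥ a + Dᵀ *ᵥ b) =
        a ⬝ᵥ P' *ᵥ a + b ⬝ᵥ V' *ᵥ b := by
      -- Both mixed terms of the quadratic form vanish, since one cross covariance is the transpose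
      -- of the other.
      have h₄ : C * P * Aᵀ + D * V * Bᵀ = 0 := by
        have := congrArg transpose h₃
        simpa [transpose_mul, hPt, hVt, Matrix.mul_assoc] using this
      have e₃ := congrArg (fun M => a ⬝ᵥ M *ᵥ b) h₃
      have e₄ := congrArg (fun M => b ⬝ᵥ M *ᵥ a) h₄
      simp only [add_mulVec, dotProduct_add, zero_mulVec, dotProduct_zero] at e₃ e₄
      rw [← h₁, ← h₂]
      simp only [mulVec_add, add_mulVec, dotProduct_add, add_dotProduct,
        dotProduct_mulVec_transpose]
      linarith
    rw [← add_div, ← add_div, ← neg_add, ← neg_add]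
    exact_mod_cast congrArg (fun r : ℝ => (-(r : ℂ)) / 2) key
  · intro x
    simp [T, hL, add_dotProduct, dotProduct_mulVec, mulVec_transpose]
  · intro x
    simp [T, hL, add_dotProduct, dotProduct_mulVec, mulVec_transpose]

theorem map_add_gaussLaw {n p n' : ℕ} {P : Matrix (Fin n) (Fin n) ℝ}
    {V : Matrix (Fin p) (Fin p) ℝ} {P' : Matrix (Fin n') (Fin n') ℝ}
    (hP : P.PosSemidef) (hV : V.PosSemidef) (hP' : P'.PosSemidef)
    (A : Matrix (Fin n') (Fin n) ℝ) (B : Matrix (Fin n') (Fin p) ℝ)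
    (h : A * P * Aᵀ + B * V * Bᵀ = P') :
    ((gaussLaw P).prod (gaussLaw V)).map (fun z => A *ᵥ z.1 + B *ᵥ z.2) = gaussLaw P' := by
  -- A second component of dimension zero makes the conditions on it vacuous; it is then projected
  -- away.
  have h' := map_prod_gaussLaw (p' := 0) (V' := 0) hP hV hP' .zero A B 0 0 h (by simp) (by simp)
  have h'' := congrArg (Measure.map Prod.fst) h'
  rw [Measure.map_map (by fun_prop) (by fun_prop), Measure.map_fst_prod] at h''
  simpa [Function.comp_def] using h''

/-! ### Matrix algebra of the Kalman filter -/

namespace Subsystem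

variable {n m p : ℕ} {S : Subsystem n m p}

theorem innovCov_psd (hS : S.WellPosed) {P : Matrix (Fin n) (Fin n) ℝ} (hP : P.PosSemidef) :
    (S.innovCov P).PosSemidef := by
  have := (hP.mul_mul_conjTranspose_same S.C).add hS.V_psd
  simpa [innovCov] using this

theorem h_psd (hS : S.WellPosed) {P : Matrix (Fin n) (Fin n) ℝ} (hP : P.PosSemidef) :
    (S.h P).PosSemidef := by
  have := (hP.mul_mul_conjTranspose_same S.A).add hS.W_psd
  simpa [h] using this

/-- The innovation covariance is that of `W` plus a positive semidefinite term. The former is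
positive semidefinite and invertible, hence positive definite, and so is the sum. Thus invertibility
for `W` alone covers all times after the first. -/
theorem isUnit_innovCov_h (hS : S.WellPosed) {P : Matrix (Fin n) (Fin n) ℝ}
    (hP : P.PosSemidef) : IsUnit (S.innovCov (S.h P)).det := by
  have h₁ : (S.innovCov S.W).PosDef := by
    rw [(innovCov_psd hS hS.W_psd).posDef_iff_isUnit, isUnit_iff_isUnit_det]
    exact hS.innov_noise
  have h₂ : S.innovCov (S.h P) = S.C * (S.A * P * S.Aᵀ) * S.Cᵀ + S.innovCov S.W := by
    simp only [innovCov, h, Matrix.mul_add, Matrix.add_mul]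
    abel
  have h₃ : (S.C * (S.A * P * S.Aᵀ) * S.Cᵀ).PosSemidef := by
    simpa using (hP.mul_mul_conjTranspose_same S.A).mul_mul_conjTranspose_same S.C
  rw [h₂, ← isUnit_iff_isUnit_det]
  exact (Matrix.PosDef.posSemidef_add h₃ h₁).isUnit

/-- The Kalman gain for prior covariance `P`. -/
noncomputable def kalman (S : Subsystem n m p) (P : Matrix (Fin n) (Fin n) ℝ) :
    Matrix (Fin n) (Fin p) ℝ := P * S.Cᵀ * (S.innovCov P)⁻¹

theorem kalman_mul_innovCov {P : Matrix (Fin n) (Fin n) ℝ} (hu : IsUnit (S.innovCov P).det) :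
    S.kalman P * S.innovCov P = P * S.Cᵀ := by
  rw [kalman, Matrix.mul_assoc, nonsing_inv_mul _ hu, Matrix.mul_one]

/-- The posterior error and the innovation are uncorrelated. -/
theorem kalman_cross {P : Matrix (Fin n) (Fin n) ℝ} (hu : IsUnit (S.innovCov P).det) :
    (1 - S.kalman P * S.C) * P * S.Cᵀ +
      -S.kalman P * S.V * (1 : Matrix (Fin p) (Fin p) ℝ)ᵀ = 0 := by
  have := kalman_mul_innovCov hu
  rw [innovCov, Matrix.mul_add] at this
  rw [transpose_one, Matrix.mul_one, Matrix.sub_mul, Matrix.one_mul, Matrix.sub_mul, ← this]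
  simp only [Matrix.mul_assoc, Matrix.neg_mul]
  abel

/-- Joseph form of the measurement update. -/
theorem joseph {P : Matrix (Fin n) (Fin n) ℝ} (hu : IsUnit (S.innovCov P).det) :
    (1 - S.kalman P * S.C) * P * (1 - S.kalman P * S.C)ᵀ +
      -S.kalman P * S.V * (-S.kalman P)ᵀ = S.g P := by
  have h₁ : S.g P = (1 - S.kalman P * S.C) * P := by
    simp only [g, kalman, Matrix.sub_mul, Matrix.one_mul, Matrix.mul_assoc]
  -- Orthogonality of posterior error and innovation, multiplied by `Kᵀ`, removes everything except
  -- `(1 - K C) P`.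
  have h₂ := congrArg (fun M => M * (S.kalman P)ᵀ) (kalman_cross hu)
  simp only [transpose_one, Matrix.mul_one, Matrix.zero_mul, Matrix.add_mul] at h₂
  rw [h₁, transpose_sub, transpose_one, transpose_mul, Matrix.mul_sub, Matrix.mul_one,
    transpose_neg, Matrix.mul_neg, ← Matrix.mul_assoc, sub_add, sub_neg_eq_add, h₂, sub_zero]

/-- The Joseph form is a sum of congruences of positive semidefinite matrices; the defining
difference hides the sign. -/
theorem g_psd (hS : S.WellPosed) {P : Matrix (Fin n) (Fin n) ℝ} (hP : P.PosSemidef)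
    (hu : IsUnit (S.innovCov P).det) : (S.g P).PosSemidef := by
  rw [← joseph hu]
  have h₁ := hP.mul_mul_conjTranspose_same (1 - S.kalman P * S.C)
  have h₂ := hS.V_psd.mul_mul_conjTranspose_same (-S.kalman P)
  rw [conjTranspose_eq_transpose_of_trivial] at h₁ h₂
  exact h₁.add h₂

/-- The two claims need a joint induction: the update keeps semidefiniteness when the innovation
covariance is invertible, and semidefiniteness gives invertibility at the next step. -/
theorem predCov_psd_and_isUnit (hS : S.WellPosed) (γ : ℕ → Bool) (t : ℕ) :
    (S.predCov γ t).PosSemidef ∧ IsUnit (S.innovCov (S.predCov γ t)).det := by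
  induction t with
  | zero => exact ⟨hS.X0_psd, hS.innov_init⟩
  | succ t ih =>
    have : (if γ t then S.g (S.predCov γ t) else S.predCov γ t).PosSemidef := by
      split
      · exact g_psd hS ih.1 ih.2
      · exact ih.1
    exact ⟨h_psd hS this, isUnit_innovCov_h hS this⟩

theorem predCov_psd (hS : S.WellPosed) (γ : ℕ → Bool) (t : ℕ) : (S.predCov γ t).PosSemidef :=
  (predCov_psd_and_isUnit hS γ t).1

theorem isUnit_innovCov_predCov (hS : S.WellPosed) (γ : ℕ → Bool) (t : ℕ) :
    IsUnit (S.innovCov (S.predCov γ t)).det :=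
  (predCov_psd_and_isUnit hS γ t).2

theorem postCov_psd (hS : S.WellPosed) (γ : ℕ → Bool) (t : ℕ) : (S.postCov γ t).PosSemidef := by
  rw [postCov]
  split
  · exact g_psd hS (predCov_psd hS γ t) (isUnit_innovCov_predCov hS γ t)
  · exact predCov_psd hS γ t

theorem Gam_psd (hS : S.WellPosed) : S.Gam.PosSemidef := by
  have hM : S.M.PosSemidef := by
    simpa [M] using (hS.Pi_psd.conjTranspose_mul_mul_same S.B).add hS.R_psd
  simpa [Gam] using hM.conjTranspose_mul_mul_same S.L

open scoped MatrixOrder in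
theorem trace_mul_nonneg {n : ℕ} {A B : Matrix (Fin n) (Fin n) ℝ} (hA : A.PosSemidef)
    (hB : B.PosSemidef) : 0 ≤ (A * B).trace := by
  obtain ⟨M, rfl⟩ := CStarAlgebra.nonneg_iff_eq_star_mul_self.mp hA.nonneg
  rw [Matrix.mul_assoc, trace_mul_comm]
  exact (hB.mul_mul_conjTranspose_same M).trace_nonneg

/-- The covariance reduction is `(C P)ᵀ (C P Cᵀ + V)⁻¹ (C P)`, a congruence of a positive
semidefinite matrix. This is why CoIL is nonnegative. -/
theorem trace_Gam_mul_sub_g_nonneg (hS : S.WellPosed) {P : Matrix (Fin n) (Fin n) ℝ}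
    (hP : P.PosSemidef) : 0 ≤ (S.Gam * (P - S.g P)).trace := by
  refine trace_mul_nonneg (Gam_psd hS) ?_
  have hPt : Pᵀ = P := hP.isHermitian.eq
  have := (innovCov_psd hS hP).inv.conjTranspose_mul_mul_same (S.C * P)
  simpa [g, hPt, Matrix.mul_assoc] using this

/-- Causality of the filter: it allows an infinite reception sequence to be replaced by a finite
history. -/
theorem predCov_congr {γ γ' : ℕ → Bool} {t : ℕ} (hγ : ∀ s < t, γ s = γ' s) :
    S.predCov γ t = S.predCov γ' t := by
  induction t with
  | zero => rfl
  | succ t ih => simp only [predCov, ih fun s hs => hγ s (by omega), hγ t (by omega)]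

theorem postCov_congr {γ γ' : ℕ → Bool} {t : ℕ} (hγ : ∀ s < t + 1, γ s = γ' s) :
    S.postCov γ t = S.postCov γ' t := by
  simp only [postCov, predCov_congr fun s hs => hγ s (Nat.lt_succ_of_lt hs), hγ t (by omega)]

theorem gain_congr {γ γ' : ℕ → Bool} {t : ℕ} (hγ : ∀ s < t, γ s = γ' s) :
    S.gain γ t = S.gain γ' t := by
  simp only [gain, predCov_congr hγ]

end Subsystem

/-! ### Conditional laws on an event -/

section CondLaw

variable {Ω E F : Type*} {m mΩ : MeasurableSpace Ω} [MeasurableSpace E] [mF : MeasurableSpace F]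
  {μ : Measure Ω} {H : Set Ω} {e : Ω → E} {z : Ω → F}
  {ρ : Measure E} {τ : Measure F}

/-- On the event `H`, the random variable `e` has law `ρ` and is independent of `m`. -/
def CondLaw (μ : Measure Ω) (H : Set Ω) (m : MeasurableSpace Ω) (e : Ω → E) (ρ : Measure E) :
    Prop :=
  ∀ A, MeasurableSet[m] A → A ⊆ H → ∀ B, MeasurableSet B → μ (A ∩ e ⁻¹' B) = μ A * ρ B

theorem CondLaw.mono (h : CondLaw μ H m e ρ) {H' : Set Ω} (hH : H' ⊆ H) : CondLaw μ H' m e ρ :=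
  fun A hA hAH => h A hA (hAH.trans hH)

theorem CondLaw.mono_right (h : CondLaw μ H m e ρ) {m' : MeasurableSpace Ω} (hm : m' ≤ m) :
    CondLaw μ H m' e ρ :=
  fun A hA => h A (hm A hA)

theorem CondLaw.congr (h : CondLaw μ H m e ρ) {e' : Ω → E} (he : ∀ ω ∈ H, e ω = e' ω) :
    CondLaw μ H m e' ρ := by
  intro A hA hAH B hB
  rw [← h A hA hAH B hB]
  congr 1
  ext ω
  simp only [Set.mem_inter_iff, Set.mem_preimage]
  exact and_congr_right fun hω => by rw [he ω (hAH hω)]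

theorem CondLaw.map (h : CondLaw μ H m e ρ) {T : E → F} (hT : Measurable T) :
    CondLaw μ H m (fun ω => T (e ω)) (ρ.map T) := by
  intro A hA hAH B hB
  rw [Measure.map_apply hT hB]
  exact h A hA hAH _ (hT hB)

theorem condLaw_of_indep (he : Measurable e)
    (hi : Indep (MeasurableSpace.comap e inferInstance) m μ) :
    CondLaw μ H m e (μ.map e) := by
  intro A hA _ B hB
  rw [Measure.map_apply he hB, Set.inter_comm, mul_comm]
  exact (Indep_iff _ _ _).1 hi _ _ ⟨B, hB, rfl⟩ hA

theorem CondLaw.map_restrict (h : CondLaw μ H m e ρ) (he : Measurable e)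
    {A : Set Ω} (hA : MeasurableSet[m] A) (hAH : A ⊆ H) :
    (μ.restrict A).map e = μ A • ρ := by
  ext B hB
  rw [Measure.map_apply he hB, Measure.restrict_apply (he hB), Set.inter_comm, h A hA hAH B hB]
  simp

/-- Adjoining an independent random variable. -/
theorem CondLaw.prodMk [IsFiniteMeasure μ] [IsFiniteMeasure ρ] [IsFiniteMeasure τ]
    (h : CondLaw μ H m e ρ) (he : Measurable e) (hz : Measurable z) (hm : m ≤ mΩ)
    (hi : Indep (MeasurableSpace.comap z inferInstance)
      (m ⊔ MeasurableSpace.comap e inferInstance) μ) (hτ : μ.map z = τ) :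
    CondLaw μ H m (fun ω => (e ω, z ω)) (ρ.prod τ) := by
  intro A hA hAH B hB
  have hA' := hm A hA
  -- On rectangles, independence splits off `z` and the conditional law of `e` treats the remaining
  -- factor; rectangles determine the product measure.
  have key : (μ.restrict A).map (fun ω => (e ω, z ω)) = (μ A • ρ).prod τ := by
    have : IsFiniteMeasure (μ A • ρ) := Measure.smul_finite _ (measure_ne_top _ _)
    refine (Measure.prod_eq fun s t hs ht => ?_).symm
    rw [Measure.map_apply (he.prodMk hz) (hs.prod ht),
      Measure.restrict_apply ((he.prodMk hz) (hs.prod ht))]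
    have h₁ : MeasurableSet[m ⊔ MeasurableSpace.comap e inferInstance] (A ∩ e ⁻¹' s) :=
      MeasurableSet.inter (le_sup_left (α := MeasurableSpace Ω) _ hA)
        (le_sup_right (α := MeasurableSpace Ω) _ ⟨s, hs, rfl⟩)
    have h₂ := (Indep_iff _ _ _).1 hi (z ⁻¹' t) (A ∩ e ⁻¹' s) ⟨t, ht, rfl⟩ h₁
    rw [← Measure.map_apply hz ht, hτ, h A hA hAH s hs] at h₂
    rw [Measure.smul_apply, smul_eq_mul, mul_comm _ (τ t), ← h₂]
    congr 1
    ext ω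
    simp only [Set.mem_inter_iff, Set.mem_preimage, Set.mem_prod]
    tauto
  have h₃ := congrArg (fun ν => ν B) key
  simp only [Measure.prod_smul_left] at h₃
  rw [Measure.map_apply (he.prodMk hz) hB, Measure.restrict_apply ((he.prodMk hz) hB),
    Set.inter_comm] at h₃
  simpa using h₃

/-- Enlarging the σ-algebra by a random variable which is independent of `e` given `m`. -/
theorem CondLaw.sup_comap [IsFiniteMeasure μ] [IsProbabilityMeasure ρ]
    [IsFiniteMeasure τ]
    (h : CondLaw μ H m (fun ω => (e ω, z ω)) (ρ.prod τ)) (hz : Measurable z)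
    (hm : m ≤ mΩ) (hH : MeasurableSet[m] H) :
    CondLaw μ H (m ⊔ MeasurableSpace.comap z inferInstance) e ρ := by
  intro G hG hGH B hB
  -- Events of the enlarged σ-algebra are preimages of measurable sets under `ω ↦ (ω, z ω)`. The
  -- claim thus becomes an equality of two measures on the product, restricted to `H` so that
  -- rectangles suffice.
  have hsup : m ⊔ MeasurableSpace.comap z inferInstance =
      MeasurableSpace.comap (fun ω => (ω, z ω)) (m.prod inferInstance) := by
    have := MeasurableSpace.comap_prodMk (mβ := m) (mγ := mF) (id : Ω → Ω) z
    rw [MeasurableSpace.comap_id] at this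
    exact this.symm
  rw [hsup] at hG
  obtain ⟨D, hD, rfl⟩ := hG
  have hpair : Measurable[mΩ, m.prod inferInstance] (fun ω => (ω, z ω)) :=
    @Measurable.prodMk _ _ _ _ m _ id z (measurable_id'' hm) hz
  have key : @Measure.map _ _ mΩ (m.prod inferInstance) (fun ω => (ω, z ω))
      (μ.restrict (H ∩ e ⁻¹' B)) =
      ρ B • @Measure.map _ _ mΩ (m.prod inferInstance) (fun ω => (ω, z ω)) (μ.restrict H) := by
    refine @Measure.ext_prod _ _ m _ _ _ _ fun {s t} hs ht => ?_
    have hst : MeasurableSet[m.prod mF] (s ×ˢ t) := @MeasurableSet.prod _ _ m mF _ _ hs ht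
    rw [Measure.smul_apply, smul_eq_mul, Measure.map_apply hpair hst, Measure.map_apply hpair hst,
      Measure.restrict_apply (hpair hst), Measure.restrict_apply (hpair hst)]
    have h₁ := h (s ∩ H) (hs.inter hH) Set.inter_subset_right (B ×ˢ t) (hB.prod ht)
    have h₂ := h (s ∩ H) (hs.inter hH) Set.inter_subset_right (Set.univ ×ˢ t)
      (MeasurableSet.univ.prod ht)
    rw [Measure.prod_prod] at h₁ h₂
    have e₁ : (fun ω => (ω, z ω)) ⁻¹' s ×ˢ t ∩ (H ∩ e ⁻¹' B) =
        s ∩ H ∩ (fun ω => (e ω, z ω)) ⁻¹' B ×ˢ t := by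
      ext ω
      simp only [Set.mem_inter_iff, Set.mem_preimage, Set.mem_prod]
      tauto
    have e₂ : (fun ω => (ω, z ω)) ⁻¹' s ×ˢ t ∩ H =
        s ∩ H ∩ (fun ω => (e ω, z ω)) ⁻¹' Set.univ ×ˢ t := by
      ext ω
      simp only [Set.mem_inter_iff, Set.mem_preimage, Set.mem_prod, Set.mem_univ]
      tauto
    rw [e₁, e₂, h₁, h₂, measure_univ, one_mul, mul_left_comm]
  have h₃ := congrArg (fun ν => ν D) key
  simp only [Measure.smul_apply, smul_eq_mul] at h₃
  rw [Measure.map_apply hpair hD, Measure.map_apply hpair hD,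
    Measure.restrict_apply (hpair hD), Measure.restrict_apply (hpair hD),
    Set.inter_eq_left.2 hGH, ← Set.inter_assoc, Set.inter_eq_left.2 hGH] at h₃
  rw [h₃, mul_comm]

/-- Conditional expectations computed from conditional laws along a finite random history. -/
theorem condExp_of_condLaw [IsFiniteMeasure μ] {ι : Type*} [Finite ι] [MeasurableSpace ι]
    [MeasurableSingletonClass ι] {ρ : ι → Measure E} {H : Ω → ι} {φ : E → ℝ} (hm : m ≤ mΩ)
    (hH : Measurable[m] H) (he : Measurable e)
    (h : ∀ c, CondLaw μ (H ⁻¹' {c}) m e (ρ c)) (hφ : Measurable φ)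
    (hint : ∀ c, Integrable φ (ρ c)) :
    Integrable (fun ω => φ (e ω)) μ ∧
      μ[fun ω => φ (e ω) | m] =ᵐ[μ] fun ω => ∫ x, φ x ∂(ρ (H ω)) := by
  have hHm : ∀ c, MeasurableSet[m] (H ⁻¹' {c}) := fun c => hH (measurableSet_singleton c)
  have hcov : ⋃ c, H ⁻¹' {c} = Set.univ := by
    ext ω; simp
  have hint' : ∀ A, MeasurableSet[m] A → ∀ c, Integrable (fun ω => φ (e ω))
      (μ.restrict (A ∩ H ⁻¹' {c})) := by
    intro A hA c
    have := (h c).map_restrict he (hA.inter (hHm c)) Set.inter_subset_right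
    have h₂ : Integrable φ ((μ.restrict (A ∩ H ⁻¹' {c})).map e) := by
      rw [this]
      exact (hint c).smul_measure (measure_ne_top _ _)
    exact h₂.comp_measurable he
  have hI : Integrable (fun ω => φ (e ω)) μ := by
    rw [← integrableOn_univ, ← hcov, integrableOn_finite_iUnion]
    intro c
    have := hint' Set.univ MeasurableSet.univ c
    rwa [Set.univ_inter] at this
  have hmean : Measurable[m] fun ω => ∫ x, φ x ∂(ρ (H ω)) :=
    (measurable_of_finite fun c => ∫ x, φ x ∂(ρ c)).comp hH
  have hmeanI : Integrable (fun ω => ∫ x, φ x ∂(ρ (H ω))) μ :=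
    (Integrable.of_finite (f := fun c => ∫ x, φ x ∂(ρ c))).comp_measurable (hH.mono hm le_rfl)
  refine ⟨hI, (ae_eq_condExp_of_forall_setIntegral_eq hm hI (fun _ _ _ => hmeanI.integrableOn)
    (fun A hA _ => ?_) hmean.stronglyMeasurable.aestronglyMeasurable).symm⟩
  have : Fintype ι := Fintype.ofFinite ι
  -- Cutting `A` along the values of the history leaves pieces on which the law of `e` is a single
  -- `ρ c`.
  have hsplit : A = ⋃ c, A ∩ H ⁻¹' {c} := by rw [← Set.inter_iUnion, hcov, Set.inter_univ]
  have hdisj : Pairwise (Function.onFun Disjoint fun c => A ∩ H ⁻¹' {c}) := by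
    intro c d hcd
    refine Set.disjoint_left.2 fun ω h₁ h₂ => hcd ?_
    rw [← (h₁.2 : H ω = c), ← (h₂.2 : H ω = d)]
  rw [hsplit, integral_iUnion_fintype (fun c => hm _ (hA.inter (hHm c))) hdisj
    (fun c => hmeanI.integrableOn), integral_iUnion_fintype (fun c => hm _ (hA.inter (hHm c))) hdisj
    (fun c => hI.integrableOn)]
  refine Finset.sum_congr rfl fun c _ => ?_
  have h₁ := (h c).map_restrict he (hA.inter (hHm c)) Set.inter_subset_right
  have h₂ : ∫ ω in A ∩ H ⁻¹' {c}, φ (e ω) ∂μ = (μ (A ∩ H ⁻¹' {c})).toReal * ∫ x, φ x ∂(ρ c) := by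
    rw [← integral_map (μ := μ.restrict (A ∩ H ⁻¹' {c})) he.aemeasurable
      hφ.aestronglyMeasurable, h₁, integral_smul_measure, smul_eq_mul]
  have h₃ : ∫ ω in A ∩ H ⁻¹' {c}, (∫ x, φ x ∂(ρ (H ω))) ∂μ =
      ∫ ω in A ∩ H ⁻¹' {c}, (∫ x, φ x ∂(ρ c)) ∂μ :=
    setIntegral_congr_fun (hm _ (hA.inter (hHm c))) fun ω hω => by
      rw [show H ω = c from hω.2]
  rw [h₂, h₃, setIntegral_const, smul_eq_mul, measureReal_def]

end CondLaw

/-! ### Error recursions and measurability -/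

section Measurability

variable {Ω : Type*} {N : ℕ} {n m p : Fin N → ℕ} (S : ∀ i, Subsystem (n i) (m i) (p i))
  (ξ : Inputs Ω n p) (δ : Schedule Ω N)

theorem measurable_mulVec_const {Ω : Type*} {𝓜 : MeasurableSpace Ω} {k l : ℕ}
    (M : Matrix (Fin k) (Fin l) ℝ) {z : Ω → Fin l → ℝ} (hz : Measurable z) :
    Measurable fun ω => M *ᵥ z ω :=
  (M.mulVecLin.continuous_of_finiteDimensional.measurable).comp hz

/-- The receptions of subsystem `i` before time `t`. -/
def hist (i : Fin N) (t : ℕ) (ω : Ω) : Fin t → Bool := fun s => recv ξ δ i ω s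

/-- Extension of a finite sequence of receptions by `false`. -/
def extendHist {t : ℕ} (c : Fin t → Bool) (s : ℕ) : Bool := if h : s < t then c ⟨s, h⟩ else false

theorem extendHist_hist (i : Fin N) (t : ℕ) (ω : Ω) {s : ℕ} (hs : s < t) :
    extendHist (hist ξ δ i t ω) s = recv ξ δ i ω s := by
  simp [extendHist, hist, hs]

/-- The covariance is a function of a finite-valued random variable, so measurability and
integrability of anything computed from it are automatic. -/
theorem covPrior_eq (i : Fin N) (t : ℕ) (ω : Ω) :
    covPrior S ξ δ i t ω = (S i).predCov (extendHist (hist ξ δ i t ω)) t :=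
  Subsystem.predCov_congr fun _ hs => (extendHist_hist ξ δ i t ω hs).symm

theorem covPost_eq (i : Fin N) (t : ℕ) (ω : Ω) :
    covPost S ξ δ i t ω = (S i).postCov (extendHist (hist ξ δ i (t + 1) ω)) t :=
  Subsystem.postCov_congr fun _ hs => (extendHist_hist ξ δ i (t + 1) ω hs).symm

/-- The innovation `y - C x̂` of subsystem `i`. -/
noncomputable def innov (i : Fin N) (t : ℕ) (ω : Ω) : Fin (p i) → ℝ :=
  (S i).C *ᵥ errPrior S ξ δ i t ω + ξ.v i t ω

/-- The innovation, if it is received. -/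
noncomputable def recvInnov (i : Fin N) (t : ℕ) (ω : Ω) : Fin (p i) → ℝ :=
  if recv ξ δ i ω t then innov S ξ δ i t ω else 0

/-- The output, if it is received. -/
noncomputable def recvOutput (i : Fin N) (t : ℕ) (ω : Ω) : Fin (p i) → ℝ :=
  if recv ξ δ i ω t then output S ξ δ i t ω else 0

theorem innov_eq (i : Fin N) (t : ℕ) (ω : Ω) :
    innov S ξ δ i t ω = output S ξ δ i t ω - (S i).C *ᵥ estPrior S ξ δ i t ω := by
  simp only [innov, output, errPrior, mulVec_sub]
  abel

theorem estPost_eq (i : Fin N) (t : ℕ) (ω : Ω) :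
    estPost S ξ δ i t ω =
      estPrior S ξ δ i t ω + (S i).gain (recv ξ δ i ω) t *ᵥ recvInnov S ξ δ i t ω := by
  rw [estPost, Subsystem.update, recvInnov, innov_eq]
  split <;> simp

theorem errPost_eq (i : Fin N) (t : ℕ) (ω : Ω) :
    errPost S ξ δ i t ω =
      errPrior S ξ δ i t ω - (S i).gain (recv ξ δ i ω) t *ᵥ recvInnov S ξ δ i t ω := by
  rw [errPost, estPost_eq, errPrior]
  abel

theorem state_succ (i : Fin N) (t : ℕ) (ω : Ω) :
    state S ξ δ i (t + 1) ω = (S i).A *ᵥ state S ξ δ i t ω +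
      (S i).B *ᵥ ((S i).L *ᵥ estPost S ξ δ i t ω) + ξ.w i t ω := rfl

theorem estPrior_succ (i : Fin N) (t : ℕ) (ω : Ω) :
    estPrior S ξ δ i (t + 1) ω = (S i).A *ᵥ estPost S ξ δ i t ω +
      (S i).B *ᵥ ((S i).L *ᵥ estPost S ξ δ i t ω) := rfl

/-- The control enters state and estimate alike and cancels, so the feedback does not appear in the
error recursion. -/
theorem errPrior_succ (i : Fin N) (t : ℕ) (ω : Ω) :
    errPrior S ξ δ i (t + 1) ω = (S i).A *ᵥ errPost S ξ δ i t ω + ξ.w i t ω := by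
  rw [errPrior, state_succ, estPrior_succ, errPost, mulVec_sub]
  abel

variable {ξ δ} {𝓜 : MeasurableSpace Ω} {i : Fin N} {t : ℕ}

theorem measurable_hist (hr : ∀ s < t, Measurable fun ω => recv ξ δ i ω s) :
    Measurable (hist ξ δ i t) :=
  measurable_pi_lambda _ fun s => hr s s.2

theorem measurable_gain_mulVec (hr : ∀ s < t, Measurable fun ω => recv ξ δ i ω s)
    {z : Ω → Fin (p i) → ℝ} (hz : Measurable z) :
    Measurable fun ω => (S i).gain (recv ξ δ i ω) t *ᵥ z ω := by
  refine measurable_pi_lambda _ fun a => ?_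
  simp only [mulVec, dotProduct]
  refine Finset.measurable_sum _ fun b _ => Measurable.mul ?_ ((measurable_pi_apply b).comp hz)
  have h : (fun ω => (S i).gain (recv ξ δ i ω) t a b) =
      (fun c => (S i).gain (extendHist c) t a b) ∘ hist ξ δ i t := by
    ext ω
    exact congrFun (congrFun (Subsystem.gain_congr fun s hs =>
      (extendHist_hist ξ δ i t ω hs).symm) a) b
  rw [h]
  exact (measurable_of_finite _).comp (measurable_hist hr)

theorem measurable_ite_recv {z : Ω → Fin (p i) → ℝ}
    (hr : Measurable fun ω => recv ξ δ i ω t) (hz : Measurable z) :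
    Measurable fun ω => if recv ξ δ i ω t then z ω else 0 :=
  Measurable.ite (hr (measurableSet_singleton true)) hz measurable_const

theorem measurable_estPost (hr : ∀ s < t, Measurable fun ω => recv ξ δ i ω s)
    (he : Measurable (estPrior S ξ δ i t)) (hz : Measurable (recvInnov S ξ δ i t)) :
    Measurable (estPost S ξ δ i t) := by
  rw [funext (estPost_eq S ξ δ i t)]
  exact he.add (measurable_gain_mulVec S hr hz)

theorem measurable_estPrior_succ (he : Measurable (estPost S ξ δ i t)) :
    Measurable (estPrior S ξ δ i (t + 1)) := by
  rw [funext (estPrior_succ S ξ δ i t)]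
  exact (measurable_mulVec_const _ he).add
    (measurable_mulVec_const _ (measurable_mulVec_const _ he))

/-- With the next but one lemma's converse direction, received outputs and received innovations
carry the same information: they differ by `C x̂`, which the past determines. -/
theorem measurable_recvInnov_of_recvOutput (hr : Measurable fun ω => recv ξ δ i ω t)
    (he : Measurable (estPrior S ξ δ i t)) (hy : Measurable (recvOutput S ξ δ i t)) :
    Measurable (recvInnov S ξ δ i t) := by
  have h : recvInnov S ξ δ i t = fun ω => if recv ξ δ i ω t then
      recvOutput S ξ δ i t ω - (S i).C *ᵥ estPrior S ξ δ i t ω else 0 := by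
    ext1 ω
    simp only [recvInnov, recvOutput, innov_eq]
    split <;> rfl
  rw [h]
  exact measurable_ite_recv hr (hy.sub (measurable_mulVec_const _ he))

theorem measurable_recvOutput_of_recvInnov (hr : Measurable fun ω => recv ξ δ i ω t)
    (he : Measurable (estPrior S ξ δ i t)) (hz : Measurable (recvInnov S ξ δ i t)) :
    Measurable (recvOutput S ξ δ i t) := by
  have h : recvOutput S ξ δ i t = fun ω => if recv ξ δ i ω t then
      recvInnov S ξ δ i t ω + (S i).C *ᵥ estPrior S ξ δ i t ω else 0 := by
    ext1 ω
    simp only [recvInnov, recvOutput, innov_eq]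
    split <;> simp
  rw [h]
  exact measurable_ite_recv hr (hz.add (measurable_mulVec_const _ he))

theorem measurable_estPrior_of_recvInnov (hr : ∀ s < t, Measurable fun ω => recv ξ δ i ω s)
    (hz : ∀ s < t, Measurable (recvInnov S ξ δ i s)) : Measurable (estPrior S ξ δ i t) := by
  induction t with
  | zero => exact measurable_const
  | succ t ih =>
    exact measurable_estPrior_succ S (measurable_estPost S (fun s hs => hr s (by omega))
      (ih (fun s hs => hr s (by omega)) fun s hs => hz s (by omega)) (hz t (by omega)))

theorem measurable_estPrior_of_recvOutput (hr : ∀ s < t, Measurable fun ω => recv ξ δ i ω s)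
    (hy : ∀ s < t, Measurable (recvOutput S ξ δ i s)) : Measurable (estPrior S ξ δ i t) := by
  induction t with
  | zero => exact measurable_const
  | succ t ih =>
    have he := ih (fun s hs => hr s (by omega)) fun s hs => hy s (by omega)
    exact measurable_estPrior_succ S (measurable_estPost S (fun s hs => hr s (by omega)) he
      (measurable_recvInnov_of_recvOutput S (hr t (by omega)) he (hy t (by omega))))

theorem measurable_state_estPrior (hx : Measurable (ξ.x0 i))
    (hw : ∀ s < t, Measurable (ξ.w i s)) (hv : ∀ s < t, Measurable (ξ.v i s))
    (hr : ∀ s < t, Measurable fun ω => recv ξ δ i ω s) :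
    Measurable (state S ξ δ i t) ∧ Measurable (estPrior S ξ δ i t) := by
  induction t with
  | zero => exact ⟨hx, measurable_const⟩
  | succ t ih =>
    obtain ⟨h₁, h₂⟩ := ih (fun s hs => hw s (by omega)) (fun s hs => hv s (by omega))
      (fun s hs => hr s (by omega))
    have hz : Measurable (recvInnov S ξ δ i t) :=
      measurable_ite_recv (hr t (by omega))
        ((measurable_mulVec_const _ (h₁.sub h₂)).add (hv t (by omega)))
    have he := measurable_estPost S (fun s hs => hr s (by omega)) h₂ hz
    refine ⟨?_, measurable_estPrior_succ S he⟩
    rw [funext (state_succ S ξ δ i t)]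
    exact ((measurable_mulVec_const _ h₁).add
      (measurable_mulVec_const _ (measurable_mulVec_const _ he))).add (hw t (by omega))

/-! ### Information -/

theorem localInfo_le (hd : ∀ s < t, Measurable fun ω => δ s ω i)
    (hr : ∀ s < t, Measurable fun ω => recv ξ δ i ω s)
    (hy : ∀ s < t, Measurable (recvOutput S ξ δ i s)) : localInfo S ξ δ i t ≤ 𝓜 :=
  iSup_le fun s => ((hd s s.2).prodMk ((hr s s.2).prodMk (hy s s.2))).comap_le

variable (ξ δ) in
theorem measurable_localInfo {s : ℕ} (hs : s < t) : Measurable[localInfo S ξ δ i t]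
    (fun ω => (δ s ω i, recv ξ δ i ω s, recvOutput S ξ δ i s ω)) := by
  have h := le_iSup (fun s : Fin t => MeasurableSpace.comap
    (fun ω => (δ s ω i, recv ξ δ i ω s, recvOutput S ξ δ i s ω)) inferInstance) ⟨s, hs⟩
  exact (comap_measurable _).mono h le_rfl

variable (ξ δ i) in
theorem measurable_recv_localInfo {s : ℕ} (hs : s < t) :
    Measurable[localInfo S ξ δ i t] (fun ω => recv ξ δ i ω s) :=
  measurable_fst.comp (measurable_snd.comp (measurable_localInfo S ξ δ hs))

variable (ξ δ i) in
theorem measurable_recvOutput_localInfo {s : ℕ} (hs : s < t) :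
    Measurable[localInfo S ξ δ i t] (recvOutput S ξ δ i s) :=
  measurable_snd.comp (measurable_snd.comp (measurable_localInfo S ξ δ hs))

variable (ξ δ i t) in
theorem measurable_hist_localInfo : Measurable[localInfo S ξ δ i t] (hist ξ δ i t) :=
  measurable_hist fun _ hs => measurable_recv_localInfo S ξ δ i hs

variable (ξ δ i t) in
theorem measurable_estPrior_localInfo : Measurable[localInfo S ξ δ i t] (estPrior S ξ δ i t) :=
  measurable_estPrior_of_recvOutput S (fun _ hs => measurable_recv_localInfo S ξ δ i hs)
    (fun _ hs => measurable_recvOutput_localInfo S ξ δ i hs)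

variable (ξ δ i t) in
theorem measurable_estPost_localInfo :
    Measurable[localInfo S ξ δ i (t + 1)] (estPost S ξ δ i t) := by
  have hr : ∀ s < t + 1, Measurable[localInfo S ξ δ i (t + 1)] (fun ω => recv ξ δ i ω s) :=
    fun _ hs => measurable_recv_localInfo S ξ δ i hs
  have hy : ∀ s < t + 1, Measurable[localInfo S ξ δ i (t + 1)] (recvOutput S ξ δ i s) :=
    fun _ hs => measurable_recvOutput_localInfo S ξ δ i hs
  have he := measurable_estPrior_of_recvOutput S (fun s hs => hr s (Nat.lt_succ_of_lt hs))
    (fun s hs => hy s (Nat.lt_succ_of_lt hs))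
  exact measurable_estPost S (fun s hs => hr s (Nat.lt_succ_of_lt hs)) he
    (measurable_recvInnov_of_recvOutput S (hr t (Nat.lt_succ_self t)) he
      (hy t (Nat.lt_succ_self t)))

theorem localInfo_le_info : localInfo S ξ δ i t ≤ info S ξ δ t :=
  le_iSup (fun i => localInfo S ξ δ i t) i

theorem measurable_recv {s : ℕ} (hd : Measurable (δ s)) (hl : Measurable (ξ.link i s)) :
    Measurable fun ω => recv ξ δ i ω s :=
  (measurable_of_finite fun b : Bool × Bool => b.1 && b.2).comp
    (((measurable_pi_apply i).comp hd).prodMk hl)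

/-- The information at time `t` is determined by the inputs before time `t`. -/
theorem info_le (hx : ∀ i, Measurable (ξ.x0 i)) (hw : ∀ i, ∀ s < t, Measurable (ξ.w i s))
    (hv : ∀ i, ∀ s < t, Measurable (ξ.v i s)) (hl : ∀ i, ∀ s < t, Measurable (ξ.link i s))
    (hδ : ∀ s < t, Measurable[info S ξ δ s] (δ s)) : info S ξ δ t ≤ 𝓜 := by
  -- Decisions at `s` are only measurable for the information at `s`, which must therefore be placed
  -- inside `𝓜` before receptions and outputs at `s` can be treated.
  induction t using Nat.strong_induction_on with
  | _ t ih =>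
    have hd : ∀ s < t, Measurable (δ s) := fun s hs => (hδ s hs).mono
      (ih s hs (fun i r hr => hw i r (hr.trans hs)) (fun i r hr => hv i r (hr.trans hs))
        (fun i r hr => hl i r (hr.trans hs)) (fun r hr => hδ r (hr.trans hs))) le_rfl
    have hr : ∀ i, ∀ s < t, Measurable fun ω => recv ξ δ i ω s :=
      fun i s hs => measurable_recv (hd s hs) (hl i s hs)
    refine iSup_le fun i => localInfo_le S
      (fun s hs => (measurable_pi_apply i).comp (hd s hs)) (hr i) fun s hs => ?_
    have hst := (measurable_state_estPrior S (hx i) (fun r hr => hw i r (hr.trans hs))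
      (fun r hr => hv i r (hr.trans hs)) (fun r h => hr i r (h.trans hs))).1
    exact measurable_ite_recv (hr i s hs) ((measurable_mulVec_const _ hst).add (hv i s hs))

/-! ### σ-algebras generated by families of inputs -/

/-- σ-algebra generated by the inputs with labels in `Λ`. -/
@[reducible] def sigmaOf (ξ : Inputs Ω n p) (Λ : Set (InputLabel N)) : MeasurableSpace Ω :=
  ⨆ l ∈ Λ, ξ.sigma l

theorem sigma_le_sigmaOf {Λ : Set (InputLabel N)} {l : InputLabel N} (hl : l ∈ Λ) :
    ξ.sigma l ≤ sigmaOf ξ Λ := le_iSup₂_of_le l hl le_rfl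

theorem sigmaOf_mono {Λ Λ' : Set (InputLabel N)} (h : Λ ⊆ Λ') : sigmaOf ξ Λ ≤ sigmaOf ξ Λ' :=
  iSup₂_le fun _ hl => sigma_le_sigmaOf (h hl)

variable (ξ) in
theorem measurable_x0 {Λ : Set (InputLabel N)} {j : Fin N} (h : InputLabel.x0 j ∈ Λ) :
    Measurable[sigmaOf ξ Λ] (ξ.x0 j) :=
  (comap_measurable _).mono (sigma_le_sigmaOf h) le_rfl

variable (ξ) in
theorem measurable_w {Λ : Set (InputLabel N)} {j : Fin N} {s : ℕ} (h : InputLabel.w j s ∈ Λ) :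
    Measurable[sigmaOf ξ Λ] (ξ.w j s) :=
  (comap_measurable _).mono (sigma_le_sigmaOf h) le_rfl

variable (ξ) in
theorem measurable_v {Λ : Set (InputLabel N)} {j : Fin N} {s : ℕ} (h : InputLabel.v j s ∈ Λ) :
    Measurable[sigmaOf ξ Λ] (ξ.v j s) :=
  (comap_measurable _).mono (sigma_le_sigmaOf h) le_rfl

variable (ξ) in
theorem measurable_link {Λ : Set (InputLabel N)} {j : Fin N} {s : ℕ}
    (h : InputLabel.link j s ∈ Λ) : Measurable[sigmaOf ξ Λ] (ξ.link j s) :=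
  (comap_measurable _).mono (sigma_le_sigmaOf h) le_rfl

/-- All inputs except the initial state and the noises of subsystem `i`. -/
def sideLabels (i : Fin N) : Set (InputLabel N) :=
  {l | l ≠ .x0 i ∧ ∀ s, l ≠ .w i s ∧ l ≠ .v i s}

/-- All inputs except the disturbances of subsystem `i` from time `a` on and its measurement
noises from time `b` on. -/
def pastLabels (i : Fin N) (a b : ℕ) : Set (InputLabel N) :=
  {l | ∀ s, (a ≤ s → l ≠ .w i s) ∧ (b ≤ s → l ≠ .v i s)}

theorem sideLabels_subset (i : Fin N) (a b : ℕ) : sideLabels i ⊆ pastLabels i a b :=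
  fun _ hl s => ⟨fun _ => (hl.2 s).1, fun _ => (hl.2 s).2⟩

/-- All inputs except those of subsystem `i`, together with the innovations received from
subsystem `i` before time `t`. -/
@[reducible] noncomputable def fullInfo (ξ : Inputs Ω n p) (δ : Schedule Ω N) (i : Fin N) :
    ℕ → MeasurableSpace Ω
  | 0 => sigmaOf ξ (sideLabels i)
  | t + 1 => fullInfo ξ δ i t ⊔ MeasurableSpace.comap (recvInnov S ξ δ i t) inferInstance

theorem fullInfo_mono : Monotone (fullInfo S ξ δ i) :=
  monotone_nat_of_le_succ fun _ => le_sup_left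

theorem measurable_recvInnov_fullInfo {s : ℕ} (hs : s < t) :
    Measurable[fullInfo S ξ δ i t] (recvInnov S ξ δ i s) :=
  (comap_measurable _).mono ((le_sup_right).trans (fullInfo_mono S hs)) le_rfl

theorem sideInfo_le_fullInfo : sigmaOf ξ (sideLabels i) ≤ fullInfo S ξ δ i t :=
  fullInfo_mono S (Nat.zero_le t)

/-- Decisions and data determine each other, but only forward in time, so strong induction applies.
Outputs of other subsystems are functions of their inputs and the receptions; those of `i` are
rebuilt from its received innovations. -/
theorem info_le_fullInfo (hδ : ∀ s < t, Measurable[info S ξ δ s] (δ s)) :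
    info S ξ δ t ≤ fullInfo S ξ δ i t := by
  induction t using Nat.strong_induction_on with
  | _ t ih =>
    have hd : ∀ s < t, Measurable[fullInfo S ξ δ i t] (δ s) := fun s hs => (hδ s hs).mono
      ((ih s hs fun r hr => hδ r (hr.trans hs)).trans (fullInfo_mono S hs.le)) le_rfl
    have hl : ∀ j s, Measurable[fullInfo S ξ δ i t] (ξ.link j s) := fun j s =>
      (measurable_link ξ (by simp [sideLabels])).mono (sideInfo_le_fullInfo S) le_rfl
    have hr : ∀ j, ∀ s < t, Measurable[fullInfo S ξ δ i t] fun ω => recv ξ δ j ω s :=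
      fun j s hs => measurable_recv (hd s hs) (hl j s)
    refine iSup_le fun j => localInfo_le S
      (fun s hs => (measurable_pi_apply j).comp (hd s hs)) (hr j) fun s hs => ?_
    have hr' : ∀ r < s, Measurable[fullInfo S ξ δ i t] fun ω => recv ξ δ j ω r :=
      fun r h => hr j r (h.trans hs)
    by_cases hj : j = i
    · subst hj
      exact measurable_recvOutput_of_recvInnov S (hr j s hs)
        (measurable_estPrior_of_recvInnov S hr' fun r h =>
          measurable_recvInnov_fullInfo S (h.trans hs)) (measurable_recvInnov_fullInfo S hs)
    · have hx : Measurable[fullInfo S ξ δ i t] (ξ.x0 j) :=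
        (measurable_x0 ξ (by simp [sideLabels, hj])).mono (sideInfo_le_fullInfo S) le_rfl
      have hw : ∀ s, Measurable[fullInfo S ξ δ i t] (ξ.w j s) := fun s =>
        (measurable_w ξ (by simp [sideLabels, hj])).mono (sideInfo_le_fullInfo S) le_rfl
      have hv : ∀ s, Measurable[fullInfo S ξ δ i t] (ξ.v j s) := fun s =>
        (measurable_v ξ (by simp [sideLabels, hj])).mono (sideInfo_le_fullInfo S) le_rfl
      have hst := (measurable_state_estPrior S hx (fun r _ => hw r) (fun r _ => hv r) hr').1
      exact measurable_ite_recv (hr j s hs) ((measurable_mulVec_const _ hst).add (hv s))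

/-- The reception at `s` is known one step before the innovation at `s`: the decision belongs to the
information at `s`, and all link states are present from the start. -/
theorem measurable_recv_fullInfo (hδ : ∀ s < t, Measurable[info S ξ δ s] (δ s)) {s : ℕ}
    (hs : s < t) {r : ℕ} (hr : s ≤ r) :
    Measurable[fullInfo S ξ δ i r] fun ω => recv ξ δ i ω s :=
  measurable_recv ((hδ s hs).mono ((info_le_fullInfo S fun r h => hδ r (h.trans hs)).trans
      (fullInfo_mono S hr)) le_rfl)
    ((measurable_link ξ (by simp [sideLabels])).mono (sideInfo_le_fullInfo S) le_rfl)

theorem measurable_w_past {a b : ℕ} (j : Fin N) {s : ℕ} (hs : s < a) :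
    Measurable[sigmaOf ξ (pastLabels i a b)] (ξ.w j s) :=
  measurable_w ξ fun r => ⟨fun hr h => by cases h; omega, nofun⟩

theorem measurable_v_past {a b : ℕ} (j : Fin N) {s : ℕ} (hs : s < b) :
    Measurable[sigmaOf ξ (pastLabels i a b)] (ξ.v j s) :=
  measurable_v ξ fun r => ⟨nofun, fun hr h => by cases h; omega⟩

theorem measurable_recv_past {a b : ℕ} (ha : t ≤ a) (hb : t ≤ b)
    (hδ : ∀ s ≤ t, Measurable[info S ξ δ s] (δ s)) :
    Measurable[sigmaOf ξ (pastLabels i a b)] fun ω => recv ξ δ i ω t := by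
  have hl : ∀ j s, Measurable[sigmaOf ξ (pastLabels i a b)] (ξ.link j s) := fun j s =>
    measurable_link ξ (by simp [pastLabels])
  exact measurable_recv ((hδ t le_rfl).mono (info_le S
    (fun j => measurable_x0 ξ (by simp [pastLabels]))
    (fun j r h => measurable_w_past j (h.trans_le ha))
    (fun j r h => measurable_v_past j (h.trans_le hb)) (fun j r _ => hl j r)
    fun r h => hδ r h.le) le_rfl) (hl i t)

theorem measurable_errPrior_past {a b : ℕ} (ha : t ≤ a) (hb : t ≤ b)
    (hδ : ∀ s < t, Measurable[info S ξ δ s] (δ s)) :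
    Measurable[sigmaOf ξ (pastLabels i a b)] (errPrior S ξ δ i t) := by
  have := measurable_state_estPrior S (measurable_x0 ξ (by simp [pastLabels]))
    (fun s hs => measurable_w_past i (hs.trans_le ha))
    (fun s hs => measurable_v_past i (hs.trans_le hb))
    (fun s hs => measurable_recv_past (i := i) (a := a) (b := b) S (hs.le.trans ha)
      (hs.le.trans hb) fun r h => hδ r (h.trans_lt hs))
  exact this.1.sub this.2

theorem measurable_recvInnov_past {a b : ℕ} (ha : t ≤ a) (hb : t + 1 ≤ b)
    (hδ : ∀ s ≤ t, Measurable[info S ξ δ s] (δ s)) :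
    Measurable[sigmaOf ξ (pastLabels i a b)] (recvInnov S ξ δ i t) :=
  measurable_ite_recv (measurable_recv_past S ha (Nat.le_of_succ_le hb) hδ)
    ((measurable_mulVec_const _ (measurable_errPrior_past S ha (Nat.le_of_succ_le hb)
      fun s hs => hδ s hs.le)).add (measurable_v_past i hb))

/-- The last innovation included is that of time `t - 1`. It involves measurement noise up to `t -
1` but disturbances only up to `t - 2`, whence the asymmetric bounds on `a` and `b`. -/
theorem fullInfo_le_past {a b : ℕ} (ha : t ≤ a + 1) (hb : t ≤ b)
    (hδ : ∀ s < t, Measurable[info S ξ δ s] (δ s)) :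
    fullInfo S ξ δ i t ≤ sigmaOf ξ (pastLabels i a b) := by
  induction t with
  | zero => exact sigmaOf_mono (sideLabels_subset i a b)
  | succ t ih =>
    exact sup_le (ih (by omega) (by omega) fun s hs => hδ s (by omega))
      (measurable_recvInnov_past S (by omega) hb
        fun s hs => hδ s (by omega)).comap_le

theorem measurable_errPost_past {a b : ℕ} (ha : t ≤ a) (hb : t + 1 ≤ b)
    (hδ : ∀ s ≤ t, Measurable[info S ξ δ s] (δ s)) :
    Measurable[sigmaOf ξ (pastLabels i a b)] (errPost S ξ δ i t) := by
  rw [funext (errPost_eq S ξ δ i t)]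
  exact (measurable_errPrior_past S ha (Nat.le_of_succ_le hb) fun s hs => hδ s hs.le).sub
    (measurable_gain_mulVec S (fun s hs => measurable_recv_past S (hs.le.trans ha) (by omega)
      fun r h => hδ r (h.trans hs.le)) (measurable_recvInnov_past S ha hb hδ))

variable (ξ δ i t) in
/-- The event that the receptions of subsystem `i` before time `t` are given by `c`. -/
def histEvent (c : ℕ → Bool) : Set Ω := {ω | ∀ s < t, recv ξ δ i ω s = c s}

theorem histEvent_succ_subset {c : ℕ → Bool} :
    histEvent ξ δ i (t + 1) c ⊆ histEvent ξ δ i t c :=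
  fun _ hω s hs => hω s (Nat.lt_succ_of_lt hs)

theorem measurableSet_histEvent {c : ℕ → Bool} {r : ℕ} (hr : t ≤ r + 1)
    (hδ : ∀ s < t, Measurable[info S ξ δ s] (δ s)) :
    MeasurableSet[fullInfo S ξ δ i r] (histEvent ξ δ i t c) := by
  have : histEvent ξ δ i t c = ⋂ s : Fin t, (fun ω => recv ξ δ i ω s) ⁻¹' {c s} := by
    ext ω
    simp [histEvent, Fin.forall_iff]
  rw [this]
  exact MeasurableSet.iInter fun s =>
    measurable_recv_fullInfo S hδ s.2 (by omega) (measurableSet_singleton _)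

theorem hist_preimage_subset (c : Fin t → Bool) :
    hist ξ δ i t ⁻¹' {c} ⊆ histEvent ξ δ i t (extendHist c) := by
  rintro ω rfl s hs
  exact (extendHist_hist ξ δ i t ω hs).symm

end Measurability

/-! ### Conditional laws of the filter errors -/

section Filter

variable {Ω : Type*} {N : ℕ} {n m p : Fin N → ℕ} {S : ∀ i, Subsystem (n i) (m i) (p i)}
  {ξ : Inputs Ω n p} {δ : Schedule Ω N} {𝓜 : MeasurableSpace Ω} {mΩ : MeasurableSpace Ω}
  {μ : Measure Ω} {i : Fin N} {t : ℕ}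

theorem sigma_le (hξ : ξ.IsModel S μ) (l : InputLabel N) : ξ.sigma l ≤ mΩ := by
  cases l with
  | x0 i => exact (hξ.x0_meas i).comap_le
  | w i t => exact (hξ.w_meas i t).comap_le
  | v i t => exact (hξ.v_meas i t).comap_le
  | link i t => exact (hξ.link_meas i t).comap_le

theorem sigmaOf_le (hξ : ξ.IsModel S μ) (Λ : Set (InputLabel N)) : sigmaOf ξ Λ ≤ mΩ :=
  iSup₂_le fun l _ => sigma_le hξ l

theorem indep_sigma_sigmaOf (hξ : ξ.IsModel S μ) {l : InputLabel N} {Λ : Set (InputLabel N)}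
    (hl : l ∉ Λ) : Indep (ξ.sigma l) (sigmaOf ξ Λ) μ := by
  have h := indep_iSup_of_disjoint (sigma_le hξ) hξ.indep (S := {l}) (T := Λ) (by simpa using hl)
  simpa using h

theorem map_eq_gaussLaw {n : ℕ} {f : Ω → Fin n → ℝ} (hf : Measurable f) {a : Fin n → ℝ}
    {P : Matrix (Fin n) (Fin n) ℝ}
    (h : μ.map (fun ω => WithLp.toLp 2 (f ω)) = multivariateGaussian (WithLp.toLp 2 a) P) :
    μ.map (fun ω => f ω - a) = gaussLaw P := by
  have h' := congrArg (Measure.map fun x : EuclideanSpace ℝ (Fin n) => WithLp.ofLp x - a) h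
  rw [Measure.map_map (by fun_prop) (by fun_prop)] at h'
  -- Both laws are affine images of one standard Gaussian, so subtracting the mean needs no
  -- condition on `P`.
  rw [show (fun ω => f ω - a) = (fun x : EuclideanSpace ℝ (Fin n) => WithLp.ofLp x - a) ∘
    (fun ω => WithLp.toLp 2 (f ω)) from rfl, h', gaussLaw, multivariateGaussian,
    multivariateGaussian, Measure.map_map (by fun_prop) (by fun_prop),
    Measure.map_map (by fun_prop) (by fun_prop)]
  congr 1
  ext x
  simp

theorem map_w (hξ : ξ.IsModel S μ) (i : Fin N) (t : ℕ) : μ.map (ξ.w i t) = gaussLaw (S i).W := by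
  simpa using map_eq_gaussLaw (a := 0) (hξ.w_meas i t) (hξ.w_law i t)

theorem map_v (hξ : ξ.IsModel S μ) (i : Fin N) (t : ℕ) : μ.map (ξ.v i t) = gaussLaw (S i).V := by
  simpa using map_eq_gaussLaw (a := 0) (hξ.v_meas i t) (hξ.v_law i t)

theorem fullInfo_le (hξ : ξ.IsModel S μ) (hδ : ∀ s < t, Measurable[info S ξ δ s] (δ s)) :
    fullInfo S ξ δ i t ≤ mΩ :=
  (fullInfo_le_past S (Nat.le_succ t) le_rfl hδ).trans (sigmaOf_le hξ _)

theorem measurable_errPrior (hξ : ξ.IsModel S μ)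
    (hδ : ∀ s < t, Measurable[info S ξ δ s] (δ s)) : Measurable (errPrior S ξ δ i t) :=
  (measurable_errPrior_past S le_rfl le_rfl hδ).mono (sigmaOf_le hξ _) le_rfl

theorem measurable_errPost (hξ : ξ.IsModel S μ)
    (hδ : ∀ s ≤ t, Measurable[info S ξ δ s] (δ s)) : Measurable (errPost S ξ δ i t) :=
  (measurable_errPost_past S le_rfl le_rfl hδ).mono (sigmaOf_le hξ _) le_rfl

/-- The measurement update. The event fixes the reception at `t` too, and `fullInfo` at `t` already
decides it, so the two cases can be treated before the innovation is adjoined. -/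
theorem condLaw_errPost_of_errPrior [IsProbabilityMeasure μ] (hS : ∀ i, (S i).WellPosed)
    (hξ : ξ.IsModel S μ) (hδ : ∀ s ≤ t, Measurable[info S ξ δ s] (δ s)) {c : ℕ → Bool}
    (h : CondLaw μ (histEvent ξ δ i t c) (fullInfo S ξ δ i t) (errPrior S ξ δ i t)
      (gaussLaw ((S i).predCov c t))) :
    CondLaw μ (histEvent ξ δ i (t + 1) c) (fullInfo S ξ δ i (t + 1)) (errPost S ξ δ i t)
      (gaussLaw ((S i).postCov c t)) := by
  have hδ' : ∀ s < t, Measurable[info S ξ δ s] (δ s) := fun s hs => hδ s hs.le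
  have hδ'' : ∀ s < t + 1, Measurable[info S ξ δ s] (δ s) := fun s hs => hδ s (by omega)
  have hfull := fullInfo_le (i := i) hξ hδ'
  have hH : MeasurableSet[fullInfo S ξ δ i t] (histEvent ξ δ i (t + 1) c) :=
    measurableSet_histEvent S le_rfl hδ''
  have he := measurable_errPrior (i := i) hξ hδ'
  have hz : Measurable (recvInnov S ξ δ i t) :=
    (measurable_recvInnov_past S (i := i) le_rfl le_rfl hδ).mono (sigmaOf_le hξ _) le_rfl
  have hP := Subsystem.predCov_psd (hS i) c t
  have hu := Subsystem.isUnit_innovCov_predCov (hS i) c t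
  replace h := h.mono (histEvent_succ_subset (i := i))
  have hgain : ∀ ω ∈ histEvent ξ δ i (t + 1) c,
      (S i).gain (recv ξ δ i ω) t = (S i).kalman ((S i).predCov c t) := fun ω hω =>
    Subsystem.gain_congr fun s hs => hω s (Nat.lt_succ_of_lt hs)
  rcases hc : c t with _ | _
  · have hpost : (S i).postCov c t = (S i).predCov c t := by simp [Subsystem.postCov, hc]
    rw [hpost]
    have hrec : ∀ ω ∈ histEvent ξ δ i (t + 1) c, recvInnov S ξ δ i t ω = 0 := fun ω hω => by
      simp [recvInnov, hω t (Nat.lt_succ_self t), hc]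
    -- Without a reception the adjoined variable is constantly `0` on the event, hence independent
    -- of the error with a Dirac law.
    refine CondLaw.sup_comap (τ := Measure.dirac 0) ?_ hz hfull hH
    have h' := h.map (T := fun x => (x, (0 : Fin (p i) → ℝ))) (by fun_prop)
    rw [← Measure.prod_dirac] at h'
    refine h'.congr fun ω hω => ?_
    rw [errPost_eq, hrec ω hω, mulVec_zero, sub_zero]
  · have hpost : (S i).postCov c t = (S i).g ((S i).predCov c t) := by
      simp [Subsystem.postCov, hc]
    rw [hpost]
    have hind : Indep (MeasurableSpace.comap (ξ.v i t) inferInstance)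
        (fullInfo S ξ δ i t ⊔ MeasurableSpace.comap (errPrior S ξ δ i t) inferInstance) μ :=
      indep_of_indep_of_le_right
        (indep_sigma_sigmaOf hξ (l := .v i t) (Λ := pastLabels i t t)
          fun h => (h t).2 le_rfl rfl)
        (sup_le (fullInfo_le_past S (Nat.le_succ t) le_rfl hδ')
          (measurable_errPrior_past S le_rfl le_rfl hδ').comap_le)
    -- The pair (prior error, noise) is mapped linearly to (posterior error, innovation); the Kalman
    -- gain is what makes the cross covariance vanish.
    have h' := (h.prodMk he (hξ.v_meas i t) hfull hind (map_v hξ i t)).map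
      (T := fun z => ((1 - (S i).kalman ((S i).predCov c t) * (S i).C) *ᵥ z.1 +
        (-(S i).kalman ((S i).predCov c t)) *ᵥ z.2,
        (S i).C *ᵥ z.1 + (1 : Matrix (Fin (p i)) (Fin (p i)) ℝ) *ᵥ z.2)) (by fun_prop)
    rw [map_prod_gaussLaw hP (hS i).V_psd (Subsystem.g_psd (hS i) hP hu)
      (Subsystem.innovCov_psd (hS i) hP) _ _ _ _ (Subsystem.joseph hu)
      (by simp [Subsystem.innovCov]) (Subsystem.kalman_cross hu)] at h'
    refine CondLaw.sup_comap (h'.congr fun ω hω => ?_) hz hfull hH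
    have hrec : recvInnov S ξ δ i t ω = innov S ξ δ i t ω := by
      simp [recvInnov, hω t (Nat.lt_succ_self t), hc]
    rw [errPost_eq, hrec, hgain ω hω, innov]
    refine Prod.ext ?_ (by simp)
    simp only [sub_mulVec, one_mulVec, neg_mulVec, mulVec_add, mulVec_mulVec]
    abel

/-- Given the receptions, the prior error is Gaussian and independent of the information. -/
theorem condLaw_errPrior [IsProbabilityMeasure μ] (hS : ∀ i, (S i).WellPosed)
    (hξ : ξ.IsModel S μ) (hδ : ∀ s < t, Measurable[info S ξ δ s] (δ s)) (c : ℕ → Bool) :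
    CondLaw μ (histEvent ξ δ i t c) (fullInfo S ξ δ i t) (errPrior S ξ δ i t)
      (gaussLaw ((S i).predCov c t)) := by
  induction t with
  | zero =>
    have h := condLaw_of_indep (H := histEvent ξ δ i 0 c) (hξ.x0_meas i)
      (indep_sigma_sigmaOf hξ (l := .x0 i) (Λ := sideLabels i) fun h => h.1 rfl)
    have h' := h.map (T := fun x => x - (S i).xbar) (by fun_prop)
    rw [Measure.map_map (by fun_prop) (hξ.x0_meas i)] at h'
    have h'' := map_eq_gaussLaw (hξ.x0_meas i) (hξ.x0_law i)
    rw [show (fun x => x - (S i).xbar) ∘ ξ.x0 i = fun ω => ξ.x0 i ω - (S i).xbar from rfl,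
      h''] at h'
    exact h'
  | succ t ih =>
    have hδ' : ∀ s ≤ t, Measurable[info S ξ δ s] (δ s) := fun s hs => hδ s (by omega)
    have h := condLaw_errPost_of_errPrior hS hξ hδ' (ih fun s hs => hδ s (by omega))
    -- The posterior error at `t` involves the measurement noise at `t` but no disturbance from `t`
    -- on, hence the bounds `t` and `t + 1`.
    have hind : Indep (MeasurableSpace.comap (ξ.w i t) inferInstance)
        (fullInfo S ξ δ i (t + 1) ⊔ MeasurableSpace.comap (errPost S ξ δ i t) inferInstance) μ :=
      indep_of_indep_of_le_right
        (indep_sigma_sigmaOf hξ (l := .w i t) (Λ := pastLabels i t (t + 1))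
          fun h => (h t).1 le_rfl rfl)
        (sup_le (fullInfo_le_past S le_rfl le_rfl hδ)
          (measurable_errPost_past S le_rfl le_rfl hδ').comap_le)
    have hP := Subsystem.postCov_psd (hS i) c t
    have h' := (h.prodMk (measurable_errPost hξ hδ') (hξ.w_meas i t) (fullInfo_le hξ hδ) hind
      (map_w hξ i t)).map (T := fun z => (S i).A *ᵥ z.1 +
        (1 : Matrix (Fin (n i)) (Fin (n i)) ℝ) *ᵥ z.2) (by fun_prop)
    rw [map_add_gaussLaw hP (hS i).W_psd (Subsystem.h_psd (hS i) hP) _ _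
      (by simp [Subsystem.h])] at h'
    refine h'.congr fun ω _ => ?_
    rw [errPrior_succ, one_mulVec]

theorem condLaw_errPost [IsProbabilityMeasure μ] (hS : ∀ i, (S i).WellPosed)
    (hξ : ξ.IsModel S μ) (hδ : ∀ s ≤ t, Measurable[info S ξ δ s] (δ s)) (c : ℕ → Bool) :
    CondLaw μ (histEvent ξ δ i (t + 1) c) (fullInfo S ξ δ i (t + 1)) (errPost S ξ δ i t)
      (gaussLaw ((S i).postCov c t)) :=
  condLaw_errPost_of_errPrior hS hξ hδ (condLaw_errPrior hS hξ (fun s hs => hδ s hs.le) c)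

theorem condExp_errPrior [IsProbabilityMeasure μ] (hS : ∀ i, (S i).WellPosed)
    (hξ : ξ.IsModel S μ) (hδ : ∀ s < t, Measurable[info S ξ δ s] (δ s))
    (h𝓜 : 𝓜 ≤ fullInfo S ξ δ i t) (hist𝓜 : Measurable[𝓜] (hist ξ δ i t))
    {φ : (Fin (n i) → ℝ) → ℝ} (hφ : Measurable φ) (hint : ∀ P, Integrable φ (gaussLaw P)) :
    Integrable (fun ω => φ (errPrior S ξ δ i t ω)) μ ∧
      μ[fun ω => φ (errPrior S ξ δ i t ω) | 𝓜] =ᵐ[μ]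
        fun ω => ∫ x, φ x ∂(gaussLaw (covPrior S ξ δ i t ω)) := by
  simp only [covPrior_eq]
  exact condExp_of_condLaw (ρ := fun c => gaussLaw ((S i).predCov (extendHist c) t))
    (h𝓜.trans (fullInfo_le hξ hδ)) hist𝓜 (measurable_errPrior hξ hδ)
    (fun c => ((condLaw_errPrior hS hξ hδ (extendHist c)).mono
      (hist_preimage_subset c)).mono_right h𝓜) hφ fun _ => hint _

theorem condExp_errPost [IsProbabilityMeasure μ] (hS : ∀ i, (S i).WellPosed)
    (hξ : ξ.IsModel S μ) (hδ : ∀ s ≤ t, Measurable[info S ξ δ s] (δ s))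
    (h𝓜 : 𝓜 ≤ fullInfo S ξ δ i (t + 1))
    (hist𝓜 : Measurable[𝓜] (hist ξ δ i (t + 1)))
    {φ : (Fin (n i) → ℝ) → ℝ} (hφ : Measurable φ) (hint : ∀ P, Integrable φ (gaussLaw P)) :
    Integrable (fun ω => φ (errPost S ξ δ i t ω)) μ ∧
      μ[fun ω => φ (errPost S ξ δ i t ω) | 𝓜] =ᵐ[μ]
        fun ω => ∫ x, φ x ∂(gaussLaw (covPost S ξ δ i t ω)) := by
  simp only [covPost_eq]
  exact condExp_of_condLaw (ρ := fun c => gaussLaw ((S i).postCov (extendHist c) t))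
    (h𝓜.trans (fullInfo_le hξ fun s hs => hδ s (by omega))) hist𝓜 (measurable_errPost hξ hδ)
    (fun c => ((condLaw_errPost hS hξ hδ (extendHist c)).mono
      (hist_preimage_subset c)).mono_right h𝓜) hφ fun _ => hint _

theorem integrable_w [IsProbabilityMeasure μ] (hξ : ξ.IsModel S μ) (i : Fin N) (t : ℕ)
    (a : Fin (n i)) : Integrable (fun ω => ξ.w i t ω a) μ := by
  have h := integrable_eval_gaussLaw (S i).W a
  rw [← map_w hξ i t] at h
  exact h.comp_measurable (hξ.w_meas i t)

theorem integrable_mulVec {Ω : Type*} {mΩ : MeasurableSpace Ω} {μ : Measure Ω} {k l : ℕ}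
    (M : Matrix (Fin k) (Fin l) ℝ) {z : Ω → Fin l → ℝ}
    (hz : ∀ a, Integrable (fun ω => z ω a) μ) (b : Fin k) :
    Integrable (fun ω => (M *ᵥ z ω) b) μ := by
  simp only [mulVec, dotProduct]
  exact integrable_finsetSum _ fun a _ => (hz a).const_mul _

theorem integrable_state [IsProbabilityMeasure μ] (hS : ∀ i, (S i).WellPosed)
    (hξ : ξ.IsModel S μ) (hδ : ∀ s < t, Measurable[info S ξ δ s] (δ s)) (a : Fin (n i)) :
    Integrable (fun ω => state S ξ δ i t ω a) μ := by
  induction t generalizing a with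
  | zero =>
    have h := integrable_eval_gaussLaw (S i).X0 a
    rw [← map_eq_gaussLaw (hξ.x0_meas i) (hξ.x0_law i)] at h
    have h' := (h.comp_measurable ((hξ.x0_meas i).sub_const _)).add
      (integrable_const ((S i).xbar a))
    refine h'.congr (ae_of_all _ fun ω => ?_)
    simp [state, Subsystem.loop]
  | succ t ih =>
    have hx := ih fun s hs => hδ s (by omega)
    have he : ∀ a, Integrable (fun ω => errPost S ξ δ i t ω a) μ := fun a =>
      (condExp_errPost hS hξ (fun s hs => hδ s (by omega)) le_rfl
        (measurable_hist fun s hs => measurable_recv_fullInfo S hδ hs hs.le)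
        (measurable_pi_apply a) fun P => integrable_eval_gaussLaw P a).1
    -- Writing the estimate as state minus error avoids estimating the random gain.
    have hxh : ∀ a, Integrable (fun ω => estPost S ξ δ i t ω a) μ := fun a => by
      refine ((hx a).sub (he a)).congr (ae_of_all _ fun ω => ?_)
      simp [errPost]
    exact ((integrable_mulVec _ hx a).add
      (integrable_mulVec _ (fun b => integrable_mulVec _ hxh b) a)).add (integrable_w hξ i t a)

theorem condExp_add_measurable [IsProbabilityMeasure μ] (h𝓜 : 𝓜 ≤ mΩ)
    {x f e : Ω → ℝ} (hx : Integrable x μ) (he : Integrable e μ) (hxe : x - f = e)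
    (hf : Measurable[𝓜] f) (h0 : μ[e | 𝓜] =ᵐ[μ] 0) : μ[x | 𝓜] =ᵐ[μ] f := by
  have hxf : x = f + e := by rw [← hxe]; abel
  have hfi : Integrable f μ := by
    have : f = x - e := by rw [← hxe]; abel
    rw [this]; exact hx.sub he
  rw [hxf]
  filter_upwards [condExp_add hfi he 𝓜, h0] with ω h₁ h₂
  rw [h₁, Pi.add_apply, h₂, condExp_of_stronglyMeasurable h𝓜 hf.stronglyMeasurable hfi]
  simp

theorem condExp_prior [IsProbabilityMeasure μ] (hS : ∀ i, (S i).WellPosed)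
    (hξ : ξ.IsModel S μ) (hδ : ∀ s < t, Measurable[info S ξ δ s] (δ s)) (a b : Fin (n i)) :
    μ[fun ω => state S ξ δ i t ω a | localInfo S ξ δ i t]
        =ᵐ[μ] (fun ω => estPrior S ξ δ i t ω a) ∧
      μ[fun ω => errPrior S ξ δ i t ω a * errPrior S ξ δ i t ω b | localInfo S ξ δ i t]
        =ᵐ[μ] (fun ω => covPrior S ξ δ i t ω a b) := by
  have hle : localInfo S ξ δ i t ≤ fullInfo S ξ δ i t :=
    (localInfo_le_info S).trans (info_le_fullInfo S hδ)
  have hh := measurable_hist_localInfo S ξ δ i t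
  have h₁ := condExp_errPrior hS hξ hδ hle hh (measurable_pi_apply a)
    fun P => integrable_eval_gaussLaw P a
  have h₂ := condExp_errPrior hS hξ hδ hle hh
    ((measurable_pi_apply a).mul (measurable_pi_apply b)) fun P => integrable_mul_gaussLaw P a b
  simp only [integral_eval_gaussLaw] at h₁
  refine ⟨condExp_add_measurable (hle.trans (fullInfo_le hξ hδ)) (integrable_state hS hξ hδ a)
    h₁.1 (by ext; simp [errPrior])
    ((measurable_pi_apply a).comp (measurable_estPrior_localInfo S ξ δ i t)) h₁.2,
    h₂.2.trans (ae_of_all _ fun ω => ?_)⟩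
  exact integral_mul_gaussLaw (Subsystem.predCov_psd (hS i) _ t) a b

theorem condExp_post [IsProbabilityMeasure μ] (hS : ∀ i, (S i).WellPosed)
    (hξ : ξ.IsModel S μ) (hδ : ∀ s ≤ t, Measurable[info S ξ δ s] (δ s)) (a b : Fin (n i)) :
    μ[fun ω => state S ξ δ i t ω a | localInfo S ξ δ i (t + 1)]
        =ᵐ[μ] (fun ω => estPost S ξ δ i t ω a) ∧
      μ[fun ω => errPost S ξ δ i t ω a * errPost S ξ δ i t ω b | localInfo S ξ δ i (t + 1)]
        =ᵐ[μ] (fun ω => covPost S ξ δ i t ω a b) := by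
  have hδ' : ∀ s < t + 1, Measurable[info S ξ δ s] (δ s) := fun s hs => hδ s (by omega)
  have hle : localInfo S ξ δ i (t + 1) ≤ fullInfo S ξ δ i (t + 1) :=
    (localInfo_le_info S).trans (info_le_fullInfo S hδ')
  have hh := measurable_hist_localInfo S ξ δ i (t + 1)
  have h₁ := condExp_errPost hS hξ hδ hle hh (measurable_pi_apply a)
    fun P => integrable_eval_gaussLaw P a
  have h₂ := condExp_errPost hS hξ hδ hle hh
    ((measurable_pi_apply a).mul (measurable_pi_apply b)) fun P => integrable_mul_gaussLaw P a b
  simp only [integral_eval_gaussLaw] at h₁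
  refine ⟨condExp_add_measurable (hle.trans (fullInfo_le hξ hδ'))
    (integrable_state hS hξ (fun s hs => hδ s hs.le) a)
    h₁.1 (by ext; simp [errPost])
    ((measurable_pi_apply a).comp (measurable_estPost_localInfo S ξ δ i t)) h₁.2,
    h₂.2.trans (ae_of_all _ fun ω => ?_)⟩
  exact integral_mul_gaussLaw (Subsystem.postCov_psd (hS i) _ t) a b

end Filter

/-! ### Dependence on past decisions only -/

namespace Subsystem

theorem loop_congr {n m p : ℕ} (S : Subsystem n m p) (x0 : Fin n → ℝ) (w : ℕ → Fin n → ℝ)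
    (v : ℕ → Fin p → ℝ) {γ γ' : ℕ → Bool} {t : ℕ} (hγ : ∀ s < t, γ s = γ' s) :
    S.loop x0 w v γ t = S.loop x0 w v γ' t := by
  induction t with
  | zero => rfl
  | succ t ih =>
    have hlt : ∀ s < t, γ s = γ' s := fun s hs => hγ s (Nat.lt_succ_of_lt hs)
    simp only [loop, ih hlt, hγ t (Nat.lt_succ_self t), S.gain_congr hlt]

end Subsystem

section Congr

variable {Ω : Type*} {N : ℕ} {n m p : Fin N → ℕ} (S : ∀ i, Subsystem (n i) (m i) (p i))
  (ξ : Inputs Ω n p) {δ δ' : Schedule Ω N} {t : ℕ}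

theorem recv_congr (h : ∀ s < t, δ s = δ' s) (i : Fin N) (ω : Ω) :
    ∀ s < t, recv ξ δ i ω s = recv ξ δ' i ω s :=
  fun s hs => by rw [recv, recv, h s hs]

/-- Replacing the decision at `k` must not change the information at `k`; otherwise the objectives
of different decisions would be conditioned on different σ-algebras. -/
theorem info_congr (h : ∀ s < t, δ s = δ' s) : info S ξ δ t = info S ξ δ' t := by
  refine iSup_congr fun i => iSup_congr fun s => ?_
  congr 1
  ext1 ω
  have hs : ∀ r < (s : ℕ), δ r = δ' r := fun r hr => h r (hr.trans s.2)
  rw [h s s.2, recv_congr ξ h i ω s s.2, output, output, state, state,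
    Subsystem.loop_congr _ _ _ _ (recv_congr ξ hs i ω)]

theorem covPrior_congr (h : ∀ s < t, δ s = δ' s) (i : Fin N) (ω : Ω) :
    covPrior S ξ δ i t ω = covPrior S ξ δ' i t ω :=
  Subsystem.predCov_congr (recv_congr ξ h i ω)

theorem coil_congr (h : ∀ s < t, δ s = δ' s) (i : Fin N) (ω : Ω) :
    coil S ξ δ i t ω = coil S ξ δ' i t ω := by
  rw [coil, coil, covPrior_congr S ξ h]

end Congr

/-! ### Gaussian expectations of quadratic forms -/

theorem trace_mul_vecMulVec {n : ℕ} (G : Matrix (Fin n) (Fin n) ℝ) (x y : Fin n → ℝ) :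
    (G * vecMulVec x y).trace = ∑ a, ∑ b, G a b * (x b * y a) := by
  simp [Matrix.trace, Matrix.mul_apply, vecMulVec_apply]

theorem measurable_trace_mul_vecMulVec {n : ℕ} (G : Matrix (Fin n) (Fin n) ℝ) :
    Measurable fun x : Fin n → ℝ => (G * vecMulVec x x).trace := by
  simp only [trace_mul_vecMulVec]
  fun_prop

theorem integrable_trace_gaussLaw {n : ℕ} (G P : Matrix (Fin n) (Fin n) ℝ) :
    Integrable (fun x => (G * vecMulVec x x).trace) (gaussLaw P) := by
  simp only [trace_mul_vecMulVec]
  exact integrable_finsetSum _ fun a _ => integrable_finsetSum _ fun b _ =>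
    (integrable_mul_gaussLaw P b a).const_mul _

theorem integral_trace_gaussLaw {n : ℕ} (G : Matrix (Fin n) (Fin n) ℝ)
    {P : Matrix (Fin n) (Fin n) ℝ} (hP : P.PosSemidef) :
    ∫ x, (G * vecMulVec x x).trace ∂(gaussLaw P) = (G * P).trace := by
  simp only [trace_mul_vecMulVec]
  rw [integral_finsetSum (f := fun a (x : Fin n → ℝ) => ∑ b, G a b * (x b * x a)) _ fun a _ =>
    integrable_finsetSum _ fun b _ => (integrable_mul_gaussLaw P b a).const_mul _]
  simp only [Matrix.trace, diag_apply, Matrix.mul_apply]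
  refine Finset.sum_congr rfl fun a _ => ?_
  rw [integral_finsetSum (f := fun b (x : Fin n → ℝ) => G a b * (x b * x a)) _ fun b _ =>
    (integrable_mul_gaussLaw P b a).const_mul _]
  refine Finset.sum_congr rfl fun b _ => ?_
  rw [integral_const_mul, integral_mul_gaussLaw hP]

/-! ### Conditional expected cost -/

section Cost

variable {Ω : Type*} {N : ℕ} {n m p : Fin N → ℕ} {S : ∀ i, Subsystem (n i) (m i) (p i)}
  {ξ : Inputs Ω n p} {δ : Schedule Ω N} {mΩ : MeasurableSpace Ω} {μ : Measure Ω}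
  {i : Fin N} {k : ℕ}

theorem measurable_comp_covPrior {𝓜 : MeasurableSpace Ω} (f : Matrix (Fin (n i)) (Fin (n i)) ℝ → ℝ)
    (h : Measurable[𝓜] (hist ξ δ i k)) : Measurable[𝓜] fun ω => f (covPrior S ξ δ i k ω) := by
  simp only [covPrior_eq]
  exact (measurable_of_finite fun c => f ((S i).predCov (extendHist c) k)).comp h

theorem integrable_comp_covPrior [IsFiniteMeasure μ] (f : Matrix (Fin (n i)) (Fin (n i)) ℝ → ℝ)
    (h : Measurable (hist ξ δ i k)) : Integrable (fun ω => f (covPrior S ξ δ i k ω)) μ := by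
  simp only [covPrior_eq]
  exact (Integrable.of_finite (f := fun c => f ((S i).predCov (extendHist c) k))).comp_measurable h

theorem info_le_of_isModel (hξ : ξ.IsModel S μ) (hδ : ∀ t < k, Measurable[info S ξ δ t] (δ t)) :
    info S ξ δ k ≤ mΩ :=
  info_le S hξ.x0_meas (fun i s _ => hξ.w_meas i s) (fun i s _ => hξ.v_meas i s)
    (fun i s _ => hξ.link_meas i s) hδ

/-- The link states at time `k` are independent of the information at the start of frame `k`. -/
theorem indep_link_info (hξ : ξ.IsModel S μ) (hδ : ∀ t < k, Measurable[info S ξ δ t] (δ t)) :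
    Indep (MeasurableSpace.comap (ξ.link i k) inferInstance) (info S ξ δ k) μ := by
  refine indep_of_indep_of_le_right
    (indep_sigma_sigmaOf hξ (l := .link i k) (Λ := {l | l ≠ .link i k}) fun h => h rfl) ?_
  exact info_le S (fun j => measurable_x0 ξ (by simp)) (fun j s _ => measurable_w ξ (by simp))
    (fun j s _ => measurable_v ξ (by simp))
    (fun j s hs => measurable_link ξ fun h => by cases h; omega) hδ

theorem integral_link [IsProbabilityMeasure μ] (hξ : ξ.IsModel S μ) (i : Fin N) (k : ℕ) :
    ∫ ω, (if ξ.link i k ω then (1 : ℝ) else 0) ∂μ = (S i).q := by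
  have hm : MeasurableSet {ω | ξ.link i k ω = true} :=
    hξ.link_meas i k (measurableSet_singleton true)
  rw [← hξ.link_prob i k, ← integral_indicator_one hm]
  refine integral_congr_ae (ae_of_all _ fun ω => ?_)
  simp [Set.indicator_apply]

/-- Conditional expected estimation cost of one subsystem at the start of frame `k`. -/
theorem condExp_trace_errPost [IsProbabilityMeasure μ] (hS : ∀ i, (S i).WellPosed)
    (hξ : ξ.IsModel S μ) (hδ : ∀ t ≤ k, Measurable[info S ξ δ t] (δ t)) (i : Fin N) :
    Integrable (fun ω => ((S i).Gam *
        vecMulVec (errPost S ξ δ i k ω) (errPost S ξ δ i k ω)).trace) μ ∧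
      μ[fun ω => ((S i).Gam * vecMulVec (errPost S ξ δ i k ω) (errPost S ξ δ i k ω)).trace |
        info S ξ δ k] =ᵐ[μ] fun ω => ((S i).Gam * covPrior S ξ δ i k ω).trace -
          (if δ k ω i then coil S ξ δ i k ω * (S i).q else 0) := by
  have hδ' : ∀ t < k, Measurable[info S ξ δ t] (δ t) := fun t ht => hδ t ht.le
  have hδ'' : ∀ t < k + 1, Measurable[info S ξ δ t] (δ t) := fun t ht => hδ t (by omega)
  have hinfo := info_le_of_isModel hξ hδ'
  have hfull : fullInfo S ξ δ i (k + 1) ≤ mΩ := fullInfo_le hξ hδ''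
  have hle : info S ξ δ k ≤ fullInfo S ξ δ i (k + 1) :=
    (info_le_fullInfo S hδ').trans (fullInfo_mono S (Nat.le_succ k))
  have hh : Measurable[info S ξ δ k] (hist ξ δ i k) :=
    (measurable_hist_localInfo S ξ δ i k).mono (localInfo_le_info S) le_rfl
  -- Conditioning goes first to the larger σ-algebra, where the reception at `k` is known and the
  -- cost is a trace of the posterior covariance; the tower property then leads down to `info`.
  obtain ⟨h₁, h₂⟩ := condExp_errPost hS hξ hδ (le_refl (fullInfo S ξ δ i (k + 1)))
    (measurable_hist fun s hs => measurable_recv_fullInfo S hδ'' hs hs.le)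
    (measurable_trace_mul_vecMulVec (S i).Gam) fun P => integrable_trace_gaussLaw _ P
  refine ⟨h₁, ?_⟩
  set a : Ω → ℝ := fun ω => ((S i).Gam * covPrior S ξ δ i k ω).trace
  set b : Ω → ℝ := fun ω => if δ k ω i then coil S ξ δ i k ω else 0
  set l : Ω → ℝ := fun ω => if ξ.link i k ω then 1 else 0
  have hdi : Measurable[info S ξ δ k] fun ω => δ k ω i :=
    (measurable_pi_apply i).comp (hδ k le_rfl)
  have hb : Measurable[info S ξ δ k] b :=
    Measurable.ite (hdi (measurableSet_singleton true))
      (measurable_comp_covPrior (fun P => ((S i).Gam * (P - (S i).g P)).trace) hh)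
      measurable_const
  have ha : Measurable[info S ξ δ k] a :=
    measurable_comp_covPrior (fun P => ((S i).Gam * P).trace) hh
  have hai : Integrable a μ :=
    integrable_comp_covPrior (fun P => ((S i).Gam * P).trace) (hh.mono hinfo le_rfl)
  have hl : Measurable[MeasurableSpace.comap (ξ.link i k) inferInstance] l :=
    (measurable_of_finite fun c : Bool => if c then (1 : ℝ) else 0).comp (comap_measurable _)
  have hlΩ : Measurable l := hl.mono (hξ.link_meas i k).comap_le le_rfl
  have hli : Integrable l μ := Integrable.of_bound hlΩ.aestronglyMeasurable 1
    (ae_of_all _ fun ω => by simp only [l]; split <;> simp)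
  have hbli : Integrable (b * l) μ := by
    have hci : Integrable (coil S ξ δ i k) μ :=
      integrable_comp_covPrior (fun P => ((S i).Gam * (P - (S i).g P)).trace)
        (hh.mono hinfo le_rfl)
    refine hci.mono ((hb.mono hinfo le_rfl).mul hlΩ).aestronglyMeasurable (ae_of_all _ fun ω => ?_)
    simp only [Pi.mul_apply, b, l]
    split <;> split <;> simp
  -- Prior cost minus a gain: `b` is known at the start of the frame, and `l` is the link state,
  -- independent of that information.
  have hpost : (fun ω => ∫ x, ((S i).Gam * vecMulVec x x).trace
      ∂(gaussLaw (covPost S ξ δ i k ω))) = a - b * l := by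
    ext ω
    rw [integral_trace_gaussLaw _ (show (covPost S ξ δ i k ω).PosSemidef from
      Subsystem.postCov_psd (hS i) _ k)]
    simp only [covPost, Subsystem.postCov, recv, a, b, l, coil, covPrior, Pi.sub_apply,
      Pi.mul_apply, Matrix.mul_sub, trace_sub]
    by_cases hd : δ k ω i = true <;> by_cases hk : ξ.link i k ω = true <;> simp [hd, hk]
  rw [hpost] at h₂
  have hcl : μ[l | info S ξ δ k] =ᵐ[μ] fun _ => (S i).q := by
    have := condExp_indep_eq (hξ.link_meas i k).comap_le hinfo hl.stronglyMeasurable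
      (indep_link_info hξ hδ')
    rwa [integral_link hξ] at this
  have htower := condExp_condExp_of_le (μ := μ) (f := fun ω => ((S i).Gam *
    vecMulVec (errPost S ξ δ i k ω) (errPost S ξ δ i k ω)).trace) hle hfull
  filter_upwards [htower, condExp_congr_ae (m := info S ξ δ k) h₂,
    condExp_sub hai hbli (info S ξ δ k),
    condExp_mul_of_stronglyMeasurable_left hb.stronglyMeasurable hbli hli, hcl]
    with ω e₁ e₂ e₃ e₄ e₅
  rw [← e₁, e₂, e₃, Pi.sub_apply, e₄, Pi.mul_apply, e₅,
    condExp_of_stronglyMeasurable hinfo ha.stronglyMeasurable hai]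
  simp only [a, b, ite_mul, zero_mul]

/-- The objective splits into a part independent of the decision and the expected `coil`
collected by it. -/
theorem objective_ae_eq [IsProbabilityMeasure μ] (hS : ∀ i, (S i).WellPosed)
    (hξ : ξ.IsModel S μ) (hδ : ∀ t < k, Measurable[info S ξ δ t] (δ t))
    {D : Ω → Fin N → Bool} (hD : Measurable[info S ξ δ k] D) :
    Integrable (stageCost S ξ (Function.update δ k D) k) μ ∧
      objective S ξ δ μ k D =ᵐ[μ] fun ω => ∑ i, (((S i).Pi * (S i).W).trace +
        (((S i).Gam * covPrior S ξ δ i k ω).trace -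
          (if D ω i then coil S ξ δ i k ω * (S i).q else 0))) := by
  have hup : ∀ t < k, Function.update δ k D t = δ t := fun t ht =>
    Function.update_of_ne ht.ne _ _
  have hinfo : ∀ t ≤ k, info S ξ (Function.update δ k D) t = info S ξ δ t := fun t ht =>
    info_congr S ξ fun s hs => hup s (hs.trans_le ht)
  have hδ' : ∀ t ≤ k, Measurable[info S ξ (Function.update δ k D) t]
      (Function.update δ k D t) := by
    intro t ht
    rw [hinfo t ht]
    rcases ht.lt_or_eq with h | rfl
    · rw [hup t h]; exact hδ t h
    · rw [Function.update_self]; exact hD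
  -- The one-subsystem formula is applied to the modified schedule; its information, covariances and
  -- CoIL at `k` are those of `δ`.
  have h := condExp_trace_errPost hS hξ hδ'
  simp only [hinfo k le_rfl, Function.update_self, covPrior_congr S ξ hup,
    coil_congr S ξ hup] at h
  have hterm : ∀ i, Integrable (fun ω => ((S i).Pi * (S i).W).trace + ((S i).Gam *
      vecMulVec (errPost S ξ (Function.update δ k D) i k ω)
        (errPost S ξ (Function.update δ k D) i k ω)).trace) μ :=
    fun i => (integrable_const _).add (h i).1
  refine ⟨integrable_finsetSum _ fun i _ => hterm i, ?_⟩
  have hsum := condExp_finsetSum (s := Finset.univ) (fun i _ => hterm i) (info S ξ δ k)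
  have hadd : ∀ i, _ := fun i => condExp_add (integrable_const ((S i).Pi * (S i).W).trace) (h i).1
    (info S ξ δ k)
  have hstage : stageCost S ξ (Function.update δ k D) k =
      ∑ i, fun ω => ((S i).Pi * (S i).W).trace + ((S i).Gam *
      vecMulVec (errPost S ξ (Function.update δ k D) i k ω)
        (errPost S ξ (Function.update δ k D) i k ω)).trace := by
    ext ω
    simp [stageCost]
  rw [objective, hstage]
  filter_upwards [hsum, ae_all_iff.2 hadd, ae_all_iff.2 fun i => (h i).2] with ω e₁ e₂ e₃
  rw [e₁, Finset.sum_apply]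
  refine Finset.sum_congr rfl fun i _ => (e₂ i).trans ?_
  rw [Pi.add_apply, e₃ i, condExp_const (info_le_of_isModel hξ hδ)]

theorem coil_nonneg (hS : ∀ i, (S i).WellPosed) (i : Fin N) (k : ℕ) (ω : Ω) :
    0 ≤ coil S ξ δ i k ω :=
  Subsystem.trace_Gam_mul_sub_g_nonneg (hS i) (Subsystem.predCov_psd (hS i) _ k)

theorem q_nonneg (hξ : ξ.IsModel S μ) (i : Fin N) : 0 ≤ (S i).q := by
  rw [← hξ.link_prob i 0]
  exact measureReal_nonneg

/-! ### Existence and optimality of the rule -/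

/-- A decision maximizing `coil * q` among the triggered subsystems, as a function of the available
information. -/
theorem exists_isCoilRule (θ : ℕ → Ω → Fin N → Bool) (hθ : Measurable[info S ξ δ k] (θ k)) :
    ∃ D : Ω → Fin N → Bool, IsCoilRule S ξ δ θ k D := by
  classical
  let val : (∀ _ : Fin N, Fin k → Bool) → Fin N → ℝ := fun c i =>
    ((S i).Gam * ((S i).predCov (extendHist (c i)) k -
      (S i).g ((S i).predCov (extendHist (c i)) k))).trace * (S i).q
  have hval : ∀ ω i, val (fun i => hist ξ δ i k ω) i = coil S ξ δ i k ω * (S i).q := by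
    intro ω i
    simp only [val, coil, covPrior_eq]
  have hex : ∀ x : (Fin N → Bool) × (∀ _ : Fin N, Fin k → Bool), ∃ d : Fin N → Bool,
      ((∀ i, x.1 i = false) → ∀ i, d i = false) ∧ ((∃ i, x.1 i = true) → ∃ i, x.1 i = true ∧
        (∀ j, x.1 j = true → val x.2 j ≤ val x.2 i) ∧ ∀ j, d j = true ↔ j = i) := by
    intro x
    by_cases hx : ∃ i, x.1 i = true
    · obtain ⟨i₀, hi₀⟩ := hx
      obtain ⟨i, hi, hmax⟩ := Finset.exists_max_image
        (Finset.univ.filter fun i => x.1 i = true) (val x.2) ⟨i₀, by simpa using hi₀⟩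
      refine ⟨fun j => decide (j = i), fun h => ?_, fun _ => ⟨i, by simpa using hi,
        fun j hj => hmax j (by simpa using hj), fun j => by simp⟩⟩
      simp [h i₀] at hi₀
    · exact ⟨fun _ => false, fun _ _ => rfl, fun h => absurd h hx⟩
  -- The maximizer is chosen on the finite set of trigger patterns and histories, so composing with
  -- the choice function preserves measurability.
  choose f hf₁ hf₂ using hex
  have hh : Measurable[info S ξ δ k] fun ω i => hist ξ δ i k ω :=
    @measurable_pi_lambda _ _ _ (info S ξ δ k) _ _ fun i =>
      (measurable_hist_localInfo S ξ δ i k).mono (localInfo_le_info S) le_rfl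
  have hpair : Measurable[info S ξ δ k] fun ω => (θ k ω, fun i => hist ξ δ i k ω) :=
    hθ.prodMk hh
  refine ⟨fun ω => f (θ k ω, fun i => hist ξ δ i k ω), (measurable_of_finite f).comp hpair,
    fun ω h => hf₁ (_, _) h, fun ω h => ?_⟩
  obtain ⟨i, h₁, h₂, h₃⟩ := hf₂ (θ k ω, fun i => hist ξ δ i k ω) h
  exact ⟨i, h₁, fun j hj => by simpa only [hval] using h₂ j hj, h₃⟩

theorem IsCoilRule.admissible {θ : ℕ → Ω → Fin N → Bool} {D : Ω → Fin N → Bool}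
    (hD : IsCoilRule S ξ δ θ k D) : Admissible S ξ δ θ k D := by
  refine ⟨hD.meas, fun ω i hi => ?_, fun ω => ?_⟩
  · by_cases hx : ∃ i, θ k ω i = true
    · obtain ⟨j, hj, -, hd⟩ := hD.argmax ω hx
      rwa [(hd i).1 hi]
    · have := hD.idle ω (by simpa using hx) i
      simp [this] at hi
  · by_cases hx : ∃ i, θ k ω i = true
    · obtain ⟨j, hj, -, hd⟩ := hD.argmax ω hx
      rw [Finset.sum_eq_single j]
      · exact Bool.toNat_le _
      · intro i _ hij
        have : D ω i = false := by simpa using mt (hd i).1 hij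
        simp [this]
      · simp
    · simp [hD.idle ω (by simpa using hx)]

/-- The decision rule collects at least as much as any admissible decision. -/
theorem IsCoilRule.sum_le (hS : ∀ i, (S i).WellPosed) (hξ : ξ.IsModel S μ)
    {θ : ℕ → Ω → Fin N → Bool} {D D' : Ω → Fin N → Bool} (hD : IsCoilRule S ξ δ θ k D)
    (hD' : Admissible S ξ δ θ k D') (ω : Ω) :
    ∑ i, (if D' ω i then coil S ξ δ i k ω * (S i).q else 0) ≤
      ∑ i, (if D ω i then coil S ξ δ i k ω * (S i).q else 0) := by
  have hnn : ∀ i, 0 ≤ coil S ξ δ i k ω * (S i).q := fun i =>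
    mul_nonneg (coil_nonneg hS i k ω) (q_nonneg hξ i)
  by_cases hx : ∃ j, D' ω j = true
  · obtain ⟨j, hj⟩ := hx
    have hθj := hD'.triggered ω j hj
    obtain ⟨i, -, hmax, hd⟩ := hD.argmax ω ⟨j, hθj⟩
    -- A competitor that transmits does so from one triggered subsystem only, so its sum is a single
    -- term, bounded by the maximum.
    have h₁ : ∑ i, (if D' ω i then coil S ξ δ i k ω * (S i).q else 0) =
        coil S ξ δ j k ω * (S j).q := by
      rw [Finset.sum_eq_single j]
      · simp [hj]
      · intro l _ hl
        rw [if_neg]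
        intro hl'
        have h₂ := Finset.add_le_sum (f := fun i => (D' ω i).toNat) (fun _ _ => Nat.zero_le _)
          (Finset.mem_univ l) (Finset.mem_univ j) hl
        have h₃ := hD'.single ω
        simp only [hl', hj, Bool.toNat_true] at h₂
        omega
      · simp
    rw [h₁]
    refine (hmax j hθj).trans ?_
    have h₄ := Finset.single_le_sum
      (f := fun i => if D ω i then coil S ξ δ i k ω * (S i).q else 0)
      (fun l _ => by split; exacts [hnn l, le_rfl]) (Finset.mem_univ i)
    simpa [(hd i).2 rfl] using h₄
  -- A silent competitor collects zero, and the gains are nonnegative.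
  · push Not at hx
    rw [Finset.sum_eq_zero fun i _ => if_neg (hx i)]
    exact Finset.sum_nonneg fun l _ => by split; exacts [hnn l, le_rfl]

theorem IsCoilRule.solves [IsProbabilityMeasure μ] (hS : ∀ i, (S i).WellPosed)
    (hξ : ξ.IsModel S μ) (hδ : ∀ t < k, Measurable[info S ξ δ t] (δ t))
    {θ : ℕ → Ω → Fin N → Bool} {D : Ω → Fin N → Bool} (hD : IsCoilRule S ξ δ θ k D) :
    Solves S ξ δ μ θ k D := by
  refine ⟨hD.admissible, fun D' hD' => ?_⟩
  filter_upwards [(objective_ae_eq hS hξ hδ hD.meas).2, (objective_ae_eq hS hξ hδ hD'.meas).2]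
    with ω e₁ e₂
  rw [e₁, e₂]
  have := hD.sum_le hS hξ hD' ω
  simp only [Finset.sum_add_distrib, Finset.sum_sub_distrib]
  linarith

end Cost

end WNCS

theorem proposition1 {Ω : Type*} [MeasurableSpace Ω] (μ : Measure Ω) [IsProbabilityMeasure μ]
    {N : ℕ} {n m p : Fin N → ℕ}
    (S : ∀ i, WNCS.Subsystem (n i) (m i) (p i)) (hS : ∀ i, (S i).WellPosed)
    (ξ : WNCS.Inputs Ω n p) (hξ : ξ.IsModel S μ)
    (θ : ℕ → Ω → Fin N → Bool) (δ : WNCS.Schedule Ω N) (k : ℕ)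
    (hδ : ∀ t < k, WNCS.Admissible S ξ δ θ t (δ t))
    (hθ : Measurable[WNCS.info S ξ δ k] (θ k)) :
    -- the matrices of the filter are the conditional error covariances, and its estimates
    -- are the conditional means
    ((∀ i, ∀ t ≤ k, ∀ a b,
        μ[fun ω => WNCS.state S ξ δ i t ω a | WNCS.localInfo S ξ δ i t]
          =ᵐ[μ] (fun ω => WNCS.estPrior S ξ δ i t ω a) ∧
        μ[fun ω => WNCS.errPrior S ξ δ i t ω a * WNCS.errPrior S ξ δ i t ω b |
            WNCS.localInfo S ξ δ i t]
          =ᵐ[μ] (fun ω => WNCS.covPrior S ξ δ i t ω a b)) ∧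
      (∀ i, ∀ t < k, ∀ a b,
        μ[fun ω => WNCS.state S ξ δ i t ω a | WNCS.localInfo S ξ δ i (t + 1)]
          =ᵐ[μ] (fun ω => WNCS.estPost S ξ δ i t ω a) ∧
        μ[fun ω => WNCS.errPost S ξ δ i t ω a * WNCS.errPost S ξ δ i t ω b |
            WNCS.localInfo S ξ δ i (t + 1)]
          =ᵐ[μ] (fun ω => WNCS.covPost S ξ δ i t ω a b))) ∧
    -- the cost of every admissible decision is integrable
    (∀ D : Ω → Fin N → Bool, WNCS.Admissible S ξ δ θ k D →
      Integrable (WNCS.stageCost S ξ (Function.update δ k D) k) μ) ∧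
    -- granting access to a maximizer of `CoIL * q` is possible and solves the problem
    (∃ D : Ω → Fin N → Bool, WNCS.IsCoilRule S ξ δ θ k D) ∧
    (∀ D : Ω → Fin N → Bool, WNCS.IsCoilRule S ξ δ θ k D → WNCS.Solves S ξ δ μ θ k D) := by
  have hδ' : ∀ t < k, Measurable[WNCS.info S ξ δ t] (δ t) := fun t ht => (hδ t ht).meas
  refine ⟨⟨fun i t ht a b => ?_, fun i t ht a b => ?_⟩, fun D hD => ?_, ?_, fun D hD => ?_⟩
  · exact WNCS.condExp_prior hS hξ (fun s hs => hδ' s (hs.trans_le ht)) a b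
  · exact WNCS.condExp_post hS hξ (fun s hs => hδ' s (hs.trans_lt ht)) a b
  · exact (WNCS.objective_ae_eq hS hξ hδ' hD.meas).1
  · exact WNCS.exists_isCoilRule θ hθ
  · exact hD.solves hS hξ hδ'
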